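/- Let $d,\ell\in\mathbb N$, $d\ge 1$, and let $\Omega\subseteq\mathbb R^d$ be a bounded open set with $\Omega=\operatorname{int}(\overline\Omega)$ (for instance a bounded polyhedral Lipschitz domain) whose boundary is the disjoint union $\partial\Omega=\Gamma_D\,\dot\cup\,\Gamma_N$. Let $\mathcal T_h$ be a conforming triangulation of $\overline\Omega$ into finitely many closed $d$-simplices such that the relative interior of each boundary side lies in $\Gamma_D$ or in $\Gamma_N$. For $\gamma\in\{\Gamma_D,\Gamma_N\}$ let $\mathcal S_h^{\gamma}$ be the set of sides whose relative interior lies in $\gamma$. Let $\Pi_h$ and $\pi_h$ denote taking mean values on elements and on sides, $\nabla_h$ the element-wise gradient, and $n$ the outward unit normal. Let $U^{cr}_\ell(\mathcal T_h)$ be the space of element-wise affine $v_h\colon\Omega\to\mathbb R^\ell$ whose jumps across inner sides have mean value zero (Crouzeix–Raviart), and $Z^{rt}_\ell(\mathcal T_h)$ the space of element-wise affine $y_h\colon\Omega\to\mathbb R^{\ell\times d}$ whose normal components are constant on each side of each element and continuous across inner sides (lowest order Raviart–Thomas, row-wise); $\operatorname{div}$ acts row-wise. Let $\phi_h\colon\Omega\times\mathbb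 R^{\ell\times d}\to\mathbb R\cup\{+\infty\}$ and $\psi_h\colon\Omega\times\mathbb R^{\ell}\to\mathbb R\cup\{+\infty\}$ be such that, for a.e. $x\in\Omega$, $\phi_h(x,\cdot)$ and $\psi_h(x,\cdot)$ are proper, convex and lower semi-continuous, and such that both are element-wise constant in $x$ (i.e. on each $T\in\mathcal T_h$, up to a null set, $\phi_h(x,\cdot)$ and $\psi_h(x,\cdot)$ do not depend on $x$). Let $\phi_h^*,\psi_h^*$ be the Fenchel conjugates with respect to the second argument. Let $g_h$ and $u_D^h$ be $\mathbb R^\ell$-valued functions that are constant on each side in $\mathcal S_h^{\Gamma_N}$ and $\mathcal S_h^{\Gamma_D}$, respectively. For $v_h\in U^{cr}_\ell(\mathcal T_h)$ and $y_h\in Z^{rt}_\ell(\mathcal T_h)$ set $$I_h^{cr}(v_h)=\int_\Omega\phi_h(\cdot,\nabla_hv_h)\,dx+\int_\Omega\psi_h(\cdot,\Pi_hv_h)\,dx-\int_{\Gamma_N}g_h\cdot\pi_hv_h\,ds+\begin{cases}0&\text{if }\pi_hv_h=u_D^h\text{ a.e. on }\Gamma_D,\\+\infty&\text{else},\end{cases}$$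 $$D_h^{rt}(y_h)=-\int_\Omega\phi_h^*(\cdot,\Pi_hy_h)\,dx-\int_\Omega\psi_h^*(\cdot,\operatorname{div}y_h)\,dx+\int_{\Gamma_D}y_hn\cdot u_D^h\,ds-\begin{cases}0&\text{if }y_hn=g_h\text{ a.e. on }\Gamma_N,\\+\infty&\text{else}.\end{cases}$$ (i) (Discrete weak duality) $\displaystyle\inf_{v_h\in U^{cr}_\ell(\mathcal T_h)}I_h^{cr}(v_h)\ \ge\ \sup_{y_h\in Z^{rt}_\ell(\mathcal T_h)}D_h^{rt}(y_h)$. (ii) Let $u_h^{cr}\in U^{cr}_\ell(\mathcal T_h)$ be a minimizer of $I_h^{cr}$ with $\pi_hu_h^{cr}=u_D^h$ a.e. on $\Gamma_D$, and let $z_h^{rt}\in Z^{rt}_\ell(\mathcal T_h)$ be a maximizer of $D_h^{rt}$ with $z_h^{rt}n=g_h$ a.e. on $\Gamma_N$ (these two boundary conditions hold automatically if $I_h^{cr}\not\equiv+\infty$ and $D_h^{rt}\not\equiv-\infty$). Then the discrete strong duality relation $I_h^{cr}(u_h^{cr})=D_h^{rt}(z_h^{rt})$ holds if and only if the discrete convex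 optimality relations $$\Pi_hz_h^{rt}:\nabla_hu_h^{cr}=\phi_h^*(\cdot,\Pi_hz_h^{rt})+\phi_h(\cdot,\nabla_hu_h^{cr}),\qquad \operatorname{div}z_h^{rt}\cdot\Pi_hu_h^{cr}=\psi_h^*(\cdot,\operatorname{div}z_h^{rt})+\psi_h(\cdot,\Pi_hu_h^{cr})$$ hold a.e. in $\Omega$. -/

import Mathlib

open MeasureTheory Geometry

noncomputable section

namespace CRRT

/-- The Euclidean space `ℝ^d`. -/
abbrev Pt (d : ℕ) := EuclideanSpace ℝ (Fin d)

/-! ### Extended-real integrals and convex analysis -/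

/-- The integral of an extended-real-valued function: integral of the positive part minus integral
of the negative part. -/
def eintegral {α : Type*} [MeasurableSpace α] (μ : Measure α) (f : α → EReal) : EReal :=
  ((∫⁻ x, (f x).toENNReal ∂μ : ENNReal) : EReal) - ((∫⁻ x, (-f x).toENNReal ∂μ : ENNReal) : EReal)

/-- A function with values in `ℝ ∪ {+∞}`, not identically `+∞`. -/
def IsProper {V : Type*} (f : V → EReal) : Prop :=
  (∀ r, f r ≠ ⊥) ∧ ∃ r, f r ≠ ⊤

/-- Convexity of an extended-real-valued function, through its epigraph. -/
def IsConvex {V : Type*} [AddCommGroup V] [Module ℝ V] (f : V → EReal) : Prop :=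
  Convex ℝ {p : V × ℝ | f p.1 ≤ (p.2 : EReal)}

/-- Proper, convex and lower semi-continuous. -/
structure IsProperConvexLsc {V : Type*} [AddCommGroup V] [Module ℝ V] [TopologicalSpace V]
    (f : V → EReal) : Prop where
  proper : IsProper f
  convex : IsConvex f
  lsc : LowerSemicontinuous f

/-- The Fenchel conjugate `f*(s) = sup_r (⟨s, r⟩ - f(r))` with respect to an inner product `B`
on `V`. -/
def conj {V : Type*} (B : V → V → ℝ) (f : V → EReal) (s : V) : EReal :=
  ⨆ r : V, ((B s r : ℝ) : EReal) - f r

/-- The Euclidean inner product on `ℝ^ℓ`. -/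
def dot {ℓ : ℕ} (a b : Fin ℓ → ℝ) : ℝ := ∑ i, a i * b i

/-- The Frobenius inner product on `ℝ^{ℓ×d}`. -/
def frob {ℓ d : ℕ} (A B : Matrix (Fin ℓ) (Fin d) ℝ) : ℝ := ∑ i, ∑ j, A i j * B i j

/-! ### Triangulations -/

/-- A (conforming) triangulation of `Ω`: a finite simplicial complex in which every face belongs to
a `d`-simplex, and whose simplices cover exactly the closure of `Ω`. -/
structure Triangulation {d : ℕ} (Ω : Set (Pt d)) where
  complex : SimplicialComplex ℝ (Pt d)
  finite_faces : complex.faces.Finite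
  pure : ∀ s ∈ complex.faces, ∃ t ∈ complex.faces, s ⊆ t ∧ t.card = d + 1
  space_eq : complex.space = closure Ω

/-- The closed simplex with the given vertices. -/
def hull {d : ℕ} (s : Finset (Pt d)) : Set (Pt d) := convexHull ℝ (s : Set (Pt d))

/-- The relative interior of the simplex with the given vertices. -/
def relint {d : ℕ} (s : Finset (Pt d)) : Set (Pt d) := intrinsicInterior ℝ (hull s)

/-- The `(d-1)`-dimensional surface measure on `ℝ^d`: the Hausdorff measure, normalized so that it
is Lebesgue measure on hyperplanes (counting measure if `d = 1`). -/
def surf (d : ℕ) : Measure (Pt d) := Measure.euclideanHausdorffMeasure (d - 1)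

/-- `n` is the outward unit normal of the `d`-simplex with vertices `T` along its side with
vertices `S`. -/
structure IsOuterNormal {d : ℕ} (T S : Finset (Pt d)) (n : Pt d) : Prop where
  norm_eq : ‖n‖ = 1
  orthogonal : ∀ p ∈ S, ∀ q ∈ S, inner ℝ n (p - q) = 0
  outward : ∀ p ∈ T, p ∉ S → ∀ q ∈ S, inner ℝ n (p - q) < 0

/-- The outward unit normal `n_T` of `T` along its side `S` (it exists and is unique for a side of
a non-degenerate simplex). -/
def outerNormal {d : ℕ} (T S : Finset (Pt d)) : Pt d := Classical.epsilon (IsOuterNormal T S)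

namespace Triangulation

variable {d : ℕ} {Ω : Set (Pt d)} (𝒯 : Triangulation Ω)

/-- The elements, given by their vertex sets. -/
def Elem := {T : Finset (Pt d) // T ∈ 𝒯.complex.faces ∧ T.card = d + 1}

/-- The element sides, given by their vertex sets. -/
def Side := {S : Finset (Pt d) // S ∈ 𝒯.complex.faces ∧ S.card = d}

/-- The sides whose relative interior lies in `Γ`. -/
def SideOn (Γ : Set (Pt d)) := {S : 𝒯.Side // relint S.1 ⊆ Γ}

instance : Finite 𝒯.Elem := (𝒯.finite_faces.subset fun _ h => h.1 :
  {T : Finset (Pt d) | T ∈ 𝒯.complex.faces ∧ T.card = d + 1}.Finite)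

instance : Finite 𝒯.Side := (𝒯.finite_faces.subset fun _ h => h.1 :
  {S : Finset (Pt d) | S ∈ 𝒯.complex.faces ∧ S.card = d}.Finite)

instance (Γ : Set (Pt d)) : Finite (𝒯.SideOn Γ) :=
  inferInstanceAs (Finite {S : 𝒯.Side // relint S.1 ⊆ Γ})

instance : Fintype 𝒯.Elem := Fintype.ofFinite _

instance (Γ : Set (Pt d)) : Fintype (𝒯.SideOn Γ) := Fintype.ofFinite _

/-- An element that has the side `S`. -/
def elemOf (S : 𝒯.Side) : 𝒯.Elem :=
  ⟨(𝒯.pure S.1 S.2.1).choose, (𝒯.pure S.1 S.2.1).choose_spec.1,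
    (𝒯.pure S.1 S.2.1).choose_spec.2.2⟩

/-! ### Broken polynomials -/

/-- The element-wise affine functions with values in `F`; a function is given by its polynomial
`v T` of degree at most one on each element `T`. -/
abbrev L1 (F : Type*) [AddCommGroup F] [Module ℝ F] := 𝒯.Elem → (Pt d →ᵃ[ℝ] F)

/-- The function that equals `c T` in the interior of the element `T` (and `0` on the null set that
the interiors do not cover). -/
def piecewise {F : Type*} [AddCommMonoid F] (c : 𝒯.Elem → F) (x : Pt d) : F :=
  ∑ T : 𝒯.Elem, Set.indicator (interior (hull T.1)) (fun _ => c T) x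

/-- `f` depends on its first argument in an element-wise constant way: up to a null set, `f x` is
the same for all `x` in an element. -/
def IsElementwiseConstant {F : Type*} (f : Pt d → F) : Prop :=
  ∀ T : 𝒯.Elem, ∃ c : F, ∀ᵐ x ∂(volume.restrict (hull T.1)), f x = c

/-- The Crouzeix--Raviart space: element-wise affine functions whose jumps across inner sides have
vanishing mean. -/
def CR : Set (𝒯.L1 ℝ) :=
  {v | ∀ (S : 𝒯.Side) (T T' : 𝒯.Elem), T ≠ T' → S.1 ⊆ T.1 → S.1 ⊆ T'.1 →
    ⨍ x in hull S.1, (v T x - v T' x) ∂(surf d) = 0}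

/-- The lowest-order Raviart--Thomas space: element-wise affine vector fields whose normal component
is constant on each side of each element and has no jump across inner sides. -/
def RT : Set (𝒯.L1 (Pt d)) :=
  {y | (∀ (T : 𝒯.Elem) (S : 𝒯.Side), S.1 ⊆ T.1 →
        ∃ c : ℝ, ∀ x ∈ hull S.1, inner ℝ (y T x) (outerNormal T.1 S.1) = c) ∧
      ∀ (S : 𝒯.Side) (T T' : 𝒯.Elem), T ≠ T' → S.1 ⊆ T.1 → S.1 ⊆ T'.1 → ∀ x ∈ hull S.1,
        inner ℝ (y T x) (outerNormal T.1 S.1) + inner ℝ (y T' x) (outerNormal T'.1 S.1) = 0}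

/-- `U^{cr}_ℓ = (S^{1,cr})^ℓ`. -/
def Ucr (ℓ : ℕ) := {v : Fin ℓ → 𝒯.L1 ℝ // ∀ i, v i ∈ 𝒯.CR}

/-- `Z^{rt}_ℓ`: matrix fields all of whose rows are Raviart--Thomas vector fields. -/
def Zrt (ℓ : ℕ) := {y : Fin ℓ → 𝒯.L1 (Pt d) // ∀ i, y i ∈ 𝒯.RT}

variable {𝒯} {ℓ : ℕ}

/-- The element-wise gradient `∇_h v`. -/
def Ucr.grad (v : 𝒯.Ucr ℓ) : Pt d → Matrix (Fin ℓ) (Fin d) ℝ :=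
  𝒯.piecewise fun T => Matrix.of fun i j => (v.1 i T).linear (EuclideanSpace.single j 1)

/-- The element-wise mean value `Π_h v`. -/
def Ucr.mean (v : 𝒯.Ucr ℓ) : Pt d → Fin ℓ → ℝ :=
  𝒯.piecewise fun T i => ⨍ x in hull T.1, v.1 i T x

/-- The side-wise mean value `π_h v`. At an inner side it is the same from both elements, and a
boundary side belongs to one element only. -/
def Ucr.sideMean (v : 𝒯.Ucr ℓ) (S : 𝒯.Side) : Fin ℓ → ℝ :=
  fun i => ⨍ x in hull S.1, v.1 i (𝒯.elemOf S) x ∂(surf d)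

/-- The element-wise mean value `Π_h y`. -/
def Zrt.mean (y : 𝒯.Zrt ℓ) : Pt d → Matrix (Fin ℓ) (Fin d) ℝ :=
  𝒯.piecewise fun T => Matrix.of fun i j => ⨍ x in hull T.1, y.1 i T x j

/-- The row-wise divergence `div y`. -/
def Zrt.div (y : 𝒯.Zrt ℓ) : Pt d → Fin ℓ → ℝ :=
  𝒯.piecewise fun T i => ∑ j, (y.1 i T).linear (EuclideanSpace.single j 1) j

/-- The normal trace `y n` on a boundary side, where it is constant, so that it can be evaluated at
the barycentre of the side. -/
def Zrt.normalTrace (y : 𝒯.Zrt ℓ) (S : 𝒯.Side) : Fin ℓ → ℝ :=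
  fun i => inner ℝ (y.1 i (𝒯.elemOf S) (S.1.centroid ℝ id)) (outerNormal (𝒯.elemOf S).1 S.1)

variable (𝒯)

/-- The `L^2` inner product over `Γ` (a union of sides, up to a null set) of two side-wise constant
functions on `Γ`. -/
def sidePairing {Γ : Set (Pt d)} (a b : 𝒯.SideOn Γ → Fin ℓ → ℝ) : ℝ :=
  ∑ S : 𝒯.SideOn Γ, (surf d).real (hull S.1.1) * dot (a S) (b S)

open Classical in
/-- The indicator functional of the condition `w = b` on `Γ`. -/
def indicatorEq {Γ : Set (Pt d)} (b w : 𝒯.SideOn Γ → Fin ℓ → ℝ) : EReal :=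
  if w = b then 0 else ⊤

/-- The discrete primal functional `I_h^{cr}`. -/
def primal {ΓD ΓN : Set (Pt d)}
    (φ : Pt d → Matrix (Fin ℓ) (Fin d) ℝ → EReal) (ψ : Pt d → (Fin ℓ → ℝ) → EReal)
    (g : 𝒯.SideOn ΓN → Fin ℓ → ℝ) (uD : 𝒯.SideOn ΓD → Fin ℓ → ℝ) (v : 𝒯.Ucr ℓ) : EReal :=
  eintegral (volume.restrict Ω) (fun x => φ x (v.grad x))
    + eintegral (volume.restrict Ω) (fun x => ψ x (v.mean x))
    - ((𝒯.sidePairing g (fun S => v.sideMean S.1) : ℝ) : EReal)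
    + 𝒯.indicatorEq uD (fun S => v.sideMean S.1)

/-- The discrete dual functional `D_h^{rt}`. -/
def dual {ΓD ΓN : Set (Pt d)}
    (φ : Pt d → Matrix (Fin ℓ) (Fin d) ℝ → EReal) (ψ : Pt d → (Fin ℓ → ℝ) → EReal)
    (g : 𝒯.SideOn ΓN → Fin ℓ → ℝ) (uD : 𝒯.SideOn ΓD → Fin ℓ → ℝ) (y : 𝒯.Zrt ℓ) : EReal :=
  -eintegral (volume.restrict Ω) (fun x => conj frob (φ x) (y.mean x))
    - eintegral (volume.restrict Ω) (fun x => conj dot (ψ x) (y.div x))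
    + ((𝒯.sidePairing (fun S => y.normalTrace S.1) uD : ℝ) : EReal)
    - 𝒯.indicatorEq g (fun S => y.normalTrace S.1)

end Triangulation

end CRRT

end

/-! The heart of the matter is a discrete integration by parts formula: the sum over all elements of
`|T| (Π y : ∇v + div y · Π v)` equals the sum over the boundary sides of `|S| (y n) · π v`
(`sum_frob_add_dot`). At an inner side the two contributions cancel, because the normal component of
`y` is constant and continuous there while the two traces of `v` have the same mean.

Since `φ` and `ψ` are element-wise constant, every integral is a finite sum over elements with
weights `|T|` (`isWeightedSum_eintegral`). Fenchel–Young on each element, combined with integration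
by parts and the boundary conditions, gives weak duality (`dual_le_primal`). For admissible
arguments, primal minus dual value is a sum of nonnegative Fenchel–Young gaps with positive weights,
so it vanishes exactly when every gap does (`primal_eq_dual_iff`).

The divergence theorem on one element is reduced to linear algebra in barycentric coordinates `λ_p`.
The mean of an affine function is the mean of its vertex values; the outward normal opposite `p` is
`-∇λ_p / |∇λ_p|`; and the area of that side is `d |∇λ_p| |T|`. Summing over elements then needs that
a side of two elements meets the interior of `closure Ω`, that no side has three elements, and that
a side of only one element lies in the boundary. -/

namespace AffineBasis

/-! ### Affine maps in barycentric coordinates and vertex permutations -/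

variable {ι E F : Type*} [Fintype ι] [AddCommGroup E] [Module ℝ E] [AddCommGroup F] [Module ℝ F]

/-- An affine map is determined by its values at the vertices. -/
theorem affineMap_apply_eq_sum (b : AffineBasis ι ℝ E) (f : E →ᵃ[ℝ] F) (x : E) :
    f x = ∑ i, b.coord i x • f (b i) := by
  conv_lhs => rw [← b.affineCombination_coord_eq_self x]
  rw [Finset.map_affineCombination _ _ _ (b.sum_coord_apply_eq_one x),
    Finset.affineCombination_eq_linear_combination _ _ _ (b.sum_coord_apply_eq_one x)]
  rfl

/-- The linear part of an affine map in terms of its values at the vertices. -/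
theorem affineMap_linear_eq_sum (b : AffineBasis ι ℝ E) (f : E →ᵃ[ℝ] F) (w : E) :
    f.linear w = ∑ i, (b.coord i).linear w • f (b i) := by
  have h : ∀ {G : Type _} [AddCommGroup G] [Module ℝ G] (g : E →ᵃ[ℝ] G),
      g.linear w = g w - g 0 := fun g => by
    have := g.linearMap_vsub w 0
    simpa using this
  rw [h, b.affineMap_apply_eq_sum f w, b.affineMap_apply_eq_sum f 0, ← Finset.sum_sub_distrib]
  refine Finset.sum_congr rfl fun i _ => ?_
  rw [← sub_smul]
  congr 1
  have := (b.coord i).linearMap_vsub w 0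
  simpa using this.symm

theorem sum_coord_linear (b : AffineBasis ι ℝ E) (w : E) : ∑ i, (b.coord i).linear w = 0 := by
  have := b.affineMap_linear_eq_sum (AffineMap.const ℝ E (1 : ℝ)) w
  simpa using this.symm

/-- The affine map that permutes the vertices. -/
noncomputable def permute (b : AffineBasis ι ℝ E) (σ : Equiv.Perm ι) : E →ᵃ[ℝ] E where
  toFun x := ∑ i, b.coord i x • b (σ i)
  linear := ∑ i, (b.coord i).linear.smulRight (b (σ i))
  map_vadd' p v := by
    have h : ∀ i, b.coord i (v + p) = (b.coord i).linear v + b.coord i p := fun i =>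
      (b.coord i).map_vadd p v
    simp only [h, vadd_eq_add, add_smul, Finset.sum_add_distrib, LinearMap.sum_apply,
      LinearMap.smulRight_apply]

theorem permute_apply (b : AffineBasis ι ℝ E) (σ : Equiv.Perm ι) (x : E) :
    b.permute σ x = ∑ i, b.coord i x • b (σ i) := rfl

@[simp] theorem permute_vertex (b : AffineBasis ι ℝ E) (σ : Equiv.Perm ι) (i : ι) :
    b.permute σ (b i) = b (σ i) := by
  classical
  simp [permute_apply, b.coord_apply]

theorem coord_permute (b : AffineBasis ι ℝ E) (σ : Equiv.Perm ι) (i : ι) (x : E) :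
    b.coord i (b.permute σ x) = b.coord (σ.symm i) x := by
  classical
  have := b.affineMap_apply_eq_sum ((b.coord i).comp (b.permute σ)) x
  rw [AffineMap.comp_apply] at this
  rw [this, Finset.sum_eq_single (σ.symm i)]
  · simp
  · intro j _ hj
    have : i ≠ σ j := fun h => hj (by simp [h])
    simp [b.coord_apply_ne this]
  · simp

theorem permute_injective (b : AffineBasis ι ℝ E) (σ : Equiv.Perm ι) :
    Function.Injective (b.permute σ) := fun x y h => b.ext_elem fun i => by
  have := congrArg (b.coord (σ i)) h
  simpa [coord_permute] using this

theorem image_permute_convexHull (b : AffineBasis ι ℝ E) (σ : Equiv.Perm ι) :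
    b.permute σ '' convexHull ℝ (Set.range b) = convexHull ℝ (Set.range b) := by
  rw [AffineMap.image_convexHull, ← Set.range_comp]
  congr 1
  have : (b.permute σ) ∘ b = b ∘ σ := funext fun i => by simp
  rw [this, Set.range_comp, σ.surjective.range_eq, Set.image_univ]

end AffineBasis

/-! ### Mean values of affine functions on a full-dimensional simplex -/

namespace AffineBasis

variable {ι E : Type*} [Fintype ι] [NormedAddCommGroup E] [NormedSpace ℝ E]
  [FiniteDimensional ℝ E] [MeasurableSpace E] [BorelSpace E]

omit [FiniteDimensional ℝ E] [BorelSpace E] in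
theorem measure_convexHull_pos (b : AffineBasis ι ℝ E) (μ : Measure E) [μ.IsAddHaarMeasure] :
    0 < μ (convexHull ℝ (Set.range b)) := by
  refine lt_of_lt_of_le ?_ (measure_mono interior_subset)
  exact isOpen_interior.measure_pos μ ⟨_, b.centroid_mem_interior_convexHull⟩

omit [FiniteDimensional ℝ E] [MeasurableSpace E] [BorelSpace E] in
theorem isCompact_convexHull (b : AffineBasis ι ℝ E) :
    IsCompact (convexHull ℝ (Set.range b)) :=
  (Set.finite_range b).isCompact_convexHull ℝ

/-- This is a change of variables along a map that sends the simplex onto itself, so its Jacobian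
must have modulus one. -/
theorem average_affineMap_permute (b : AffineBasis ι ℝ E) (μ : Measure E) [μ.IsAddHaarMeasure]
    (σ : Equiv.Perm ι) (f : E →ᵃ[ℝ] ℝ) :
    ⨍ x in convexHull ℝ (Set.range b), f (b.permute σ x) ∂μ =
      ⨍ x in convexHull ℝ (Set.range b), f x ∂μ := by
  set K := convexHull ℝ (Set.range b)
  have hK : IsCompact K := b.isCompact_convexHull
  have key : ∀ g : E → ℝ, ∫ x in K, g x ∂μ =
      |(LinearMap.toContinuousLinearMap (b.permute σ).linear).det| •
        ∫ x in K, g (b.permute σ x) ∂μ := by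
    intro g
    have := integral_image_eq_integral_abs_det_fderiv_smul μ hK.measurableSet
      (f := b.permute σ) (f' := fun _ => LinearMap.toContinuousLinearMap (b.permute σ).linear)
      (fun x _ => (?_ : HasFDerivAt _ _ x).hasFDerivWithinAt) (b.permute_injective σ).injOn g
    · rw [b.image_permute_convexHull] at this
      rw [this, integral_smul]
    · have h := (LinearMap.toContinuousLinearMap (b.permute σ).linear).hasFDerivAt (x := x)
      have h2 := h.add_const (b.permute σ 0)
      refine h2.congr_of_eventuallyEq (Filter.Eventually.of_forall fun z => ?_)
      have := (b.permute σ).map_vadd 0 z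
      simpa using this
  -- Applied to the constant 1, the substitution rule compares the volume of `K` with itself and
  -- forces `|det| = 1`.
  have hone := key fun _ => 1
  have hpos : 0 < ∫ _ in K, (1 : ℝ) ∂μ := by
    simp only [integral_const, smul_eq_mul, mul_one, Measure.real, Measure.restrict_apply_univ]
    exact ENNReal.toReal_pos (b.measure_convexHull_pos μ).ne' hK.measure_lt_top.ne
  have hdet : |(LinearMap.toContinuousLinearMap (b.permute σ).linear).det| = 1 := by
    rw [smul_eq_mul] at hone
    exact (mul_eq_right₀ hpos.ne').1 hone.symm
  rw [setAverage_eq, setAverage_eq, key fun x => f x, hdet, one_smul]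

/-- The mean value of an affine function on a simplex is the mean of its vertex values. -/
theorem setAverage_affineMap (b : AffineBasis ι ℝ E) (μ : Measure E) [μ.IsAddHaarMeasure]
    (f : E →ᵃ[ℝ] ℝ) :
    ⨍ x in convexHull ℝ (Set.range b), f x ∂μ = (∑ i, f (b i)) / Fintype.card ι := by
  classical
  set K := convexHull ℝ (Set.range b)
  have hK : IsCompact K := b.isCompact_convexHull
  have hint : ∀ g : E →ᵃ[ℝ] ℝ, IntegrableOn (fun x => g x) K μ := fun g =>
    g.continuous_of_finiteDimensional.continuousOn.integrableOn_compact hK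
  have hμ : μ.real K ≠ 0 :=
    (ENNReal.toReal_pos (b.measure_convexHull_pos μ).ne' hK.measure_lt_top.ne).ne'
  -- Swapping two vertices shows that all barycentric coordinates have the same mean; as they sum to
  -- 1, this mean is `1 / card ι`.
  have hconst : ∀ i j, ⨍ x in K, b.coord i x ∂μ = ⨍ x in K, b.coord j x ∂μ := fun i j => by
    rw [← b.average_affineMap_permute μ (Equiv.swap i j) (b.coord i)]
    simp [coord_permute, K]
  have hsum : ∀ c : ι → ℝ, ⨍ x in K, ∑ i, b.coord i x * c i ∂μ =
      ∑ i, (⨍ x in K, b.coord i x ∂μ) * c i := fun c => by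
    simp only [setAverage_eq]
    rw [integral_finsetSum _ fun i _ => (hint _).mul_const _, Finset.smul_sum]
    refine Finset.sum_congr rfl fun i _ => ?_
    rw [integral_mul_const]; simp [mul_assoc]
  have hcoord : ∀ i, ⨍ x in K, b.coord i x ∂μ = 1 / Fintype.card ι := fun i => by
    have h1 := hsum fun _ => 1
    simp only [mul_one, b.sum_coord_apply_eq_one] at h1
    rw [setAverage_const (fun h => hμ (by simp [Measure.real, h])) hK.measure_lt_top.ne,
      Finset.sum_congr rfl fun j _ => hconst j i] at h1
    have hc : (Fintype.card ι : ℝ) ≠ 0 := by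
      intro h0
      simp [h0] at h1
    rw [eq_div_iff hc, h1]
    simp [mul_comm]
  have hf : ∀ x, f x = ∑ i, b.coord i x * f (b i) := b.affineMap_apply_eq_sum f
  rw [setAverage_congr_fun hK.measurableSet (Filter.Eventually.of_forall fun x _ => hf x), hsum]
  simp only [hcoord, ← Finset.mul_sum]
  ring

end AffineBasis

/-! ### Faces, gradients of barycentric coordinates and the area of a side -/

namespace AffineBasis

section Face

variable {ι E : Type*} [Fintype ι] [AddCommGroup E] [Module ℝ E]

/-- A face of a simplex in barycentric coordinates. -/
theorem mem_convexHull_image_iff (b : AffineBasis ι ℝ E) (s : Set ι) (x : E) :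
    x ∈ convexHull ℝ (b '' s) ↔ (∀ i, 0 ≤ b.coord i x) ∧ ∀ i ∉ s, b.coord i x = 0 := by
  classical
  constructor
  · intro hx
    have h1 : x ∈ convexHull ℝ (Set.range b) := convexHull_mono (Set.image_subset_range _ _) hx
    rw [b.convexHull_eq_nonneg_coord] at h1
    refine ⟨h1, fun i hi => ?_⟩
    have h2 : convexHull ℝ (b '' s) ⊆ b.coord i ⁻¹' {0} := by
      refine convexHull_min ?_ ((convex_singleton (0 : ℝ)).affine_preimage _)
      rintro _ ⟨j, hj, rfl⟩
      have : i ≠ j := fun h => hi (h ▸ hj)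
      simp [b.coord_apply_ne this]
    exact h2 hx
  · rintro ⟨h0, hz⟩
    have hsupp : ∀ i ∈ Finset.univ, i ∉ Finset.univ.filter (· ∈ s) → b.coord i x = 0 := by
      intro i _ hi
      exact hz i (by simpa using hi)
    have hx : x = ∑ i ∈ Finset.univ.filter (· ∈ s), b.coord i x • b i := by
      conv_lhs => rw [← b.linear_combination_coord_eq_self x]
      exact (Finset.sum_subset (Finset.filter_subset _ _) fun i hi hi' => by
        rw [hsupp i hi hi', zero_smul]).symm
    rw [hx]
    refine (convex_convexHull ℝ _).sum_mem (fun i _ => h0 i) ?_ fun i hi => ?_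
    · rw [Finset.sum_subset (Finset.filter_subset _ _) hsupp, b.sum_coord_apply_eq_one]
    · exact subset_convexHull ℝ _ ⟨i, by simpa using hi, rfl⟩

end Face

section Gradient

variable {ι E : Type*} [Fintype ι] [NormedAddCommGroup E] [InnerProductSpace ℝ E]
  [FiniteDimensional ℝ E]

/-- The gradient of a barycentric coordinate. -/
noncomputable def gradCoord (b : AffineBasis ι ℝ E) (p : ι) : E :=
  (InnerProductSpace.toDual ℝ E).symm (LinearMap.toContinuousLinearMap (b.coord p).linear)

omit [Fintype ι] in
theorem inner_gradCoord (b : AffineBasis ι ℝ E) (p : ι) (w : E) :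
    inner ℝ (b.gradCoord p) w = (b.coord p).linear w := by
  simp [gradCoord]

omit [Fintype ι] in
theorem coord_sub_coord (b : AffineBasis ι ℝ E) (p : ι) (x y : E) :
    inner ℝ (b.gradCoord p) (x - y) = b.coord p x - b.coord p y := by
  rw [inner_gradCoord]
  exact (b.coord p).linearMap_vsub x y

omit [Fintype ι] in
theorem gradCoord_ne_zero [Nontrivial ι] (b : AffineBasis ι ℝ E) (p : ι) : b.gradCoord p ≠ 0 := by
  obtain ⟨q, hq⟩ := exists_ne p
  intro h
  have := b.coord_sub_coord p (b p) (b q)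
  rw [h, b.coord_apply_eq, b.coord_apply_ne hq.symm] at this
  simp at this

omit [FiniteDimensional ℝ E] in
/-- Slices of a simplex parallel to a side are homothetic images of that side. -/
theorem convexHull_inter_coord_eq (b : AffineBasis ι ℝ E) (p : ι) {x : ℝ} (hx : x ∈ Set.Ico 0 1) :
    convexHull ℝ (Set.range b) ∩ {z | b.coord p z = x} =
      AffineMap.homothety (b p) (1 - x) '' convexHull ℝ (b '' {p}ᶜ) := by
  have hx1 : (1 - x) ≠ 0 := by linarith [hx.2]
  have hx2 : 0 < (1 - x) := by linarith [hx.2]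
  have hh : ∀ (c : ℝ) (i : ι) (z : E), b.coord i (AffineMap.homothety (b p) c z) =
      c * (b.coord i z - b.coord i (b p)) + b.coord i (b p) := fun c i z => by
    rw [AffineMap.homothety_eq_lineMap, AffineMap.apply_lineMap, AffineMap.lineMap_apply]
    simp
  ext z
  rw [b.convexHull_eq_nonneg_coord]
  constructor
  · rintro ⟨h0, hz⟩
    -- Blowing up from the vertex `b p` sends the level `x` of the coordinate to the level `(x - 1)
    -- / (1 - x) + 1 = 0`, that is, to the opposite side.
    refine ⟨AffineMap.homothety (b p) (1 - x)⁻¹ z, ?_, ?_⟩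
    · have hp : b.coord p (AffineMap.homothety (b p) (1 - x)⁻¹ z) = 0 := by
        rw [hh, b.coord_apply_eq, hz]
        field_simp
        ring
      rw [mem_convexHull_image_iff]
      refine ⟨fun i => ?_, fun i hi => ?_⟩
      · by_cases hi : i = p
        · rw [hi, hp]
        · rw [hh, b.coord_apply_ne hi]
          have := h0 i
          simp only [sub_zero, add_zero]
          positivity
      · obtain rfl : i = p := by simpa using hi
        exact hp
    · rw [← AffineMap.comp_apply, ← AffineMap.homothety_mul, mul_inv_cancel₀ hx1]
      simp
  · rintro ⟨w, hw, rfl⟩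
    rw [mem_convexHull_image_iff] at hw
    have hp : b.coord p w = 0 := hw.2 p (by simp)
    refine ⟨fun i => ?_, ?_⟩
    · by_cases hi : i = p
      · rw [hi, hh, hp, b.coord_apply_eq]; linarith [hx.1]
      · rw [hh, b.coord_apply_ne hi]
        have := hw.1 i
        simp only [sub_zero, add_zero]
        positivity
    · simp [hh, hp]

end Gradient

end AffineBasis

/-- The slice of a simplex at level `x` of a barycentric coordinate is the opposite side shrunk by
`1 - x`; its area carries the factor `(1 - x) ^ n`, which is integrated here to obtain the volume of
the cone. -/
theorem lintegral_one_sub_pow (n : ℕ) :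
    ∫⁻ x in Set.Ico (0 : ℝ) 1, ENNReal.ofReal ((1 - x) ^ n) = ENNReal.ofReal (1 / (n + 1)) := by
  have hcont : Continuous fun x : ℝ => (1 - x) ^ n := by fun_prop
  rw [← ofReal_integral_eq_lintegral_ofReal]
  · rw [integral_Ico_eq_integral_Ioo, ← integral_Ioc_eq_integral_Ioo,
      ← intervalIntegral.integral_of_le zero_le_one,
      intervalIntegral.integral_comp_sub_left (fun x => x ^ n) 1]
    simp
  · exact (hcont.continuousOn.integrableOn_Icc (a := 0) (b := 1)).mono_set Set.Ico_subset_Icc_self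
  · refine (ae_restrict_iff' measurableSet_Ico).2 (Filter.Eventually.of_forall fun x hx => ?_)
    have : 0 ≤ 1 - x := by linarith [hx.2]
    exact pow_nonneg this n

/-- The area of a side of a simplex is its dimension times its volume divided by the height. -/
theorem AffineBasis.surface_eq {ι : Type*} [Fintype ι] {n : ℕ} [Nontrivial ι]
    (b : AffineBasis ι ℝ (EuclideanSpace ℝ (Fin (n + 1)))) (p : ι) :
    (Measure.euclideanHausdorffMeasure n).real (convexHull ℝ (b '' {p}ᶜ)) =
      (n + 1) * ‖b.gradCoord p‖ * volume.real (convexHull ℝ (Set.range b)) := by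
  obtain ⟨q, hq⟩ := exists_ne p
  set G := b.gradCoord p with hG
  have hG0 : G ≠ 0 := b.gradCoord_ne_zero p
  have hGn : ‖G‖ ≠ 0 := norm_ne_zero_iff.2 hG0
  -- With this scaling the coordinate grows by exactly 1 along `v`: the hyperplanes orthogonal to
  -- `v` are its level sets, and `‖v‖ = ‖G‖⁻¹` is the height of the simplex over the side.
  set v := (‖G‖ ^ 2)⁻¹ • G with hv
  have hv0 : v ≠ 0 := smul_ne_zero (by positivity) hG0
  set T := convexHull ℝ (Set.range b) with hT
  set S := convexHull ℝ (b '' {p}ᶜ) with hS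
  have hplane : ∀ x : ℝ, (AffineSubspace.mk' (x • v +ᵥ b q) (ℝ ∙ v)ᗮ : Set _) =
      {z | b.coord p z = x} := by
    intro x
    ext z
    rw [SetLike.mem_coe, AffineSubspace.mem_mk', Submodule.mem_orthogonal_singleton_iff_inner_right,
      hv, inner_smul_left, vsub_eq_sub, vadd_eq_add]
    have h1 : inner ℝ G (z - (x • (‖G‖ ^ 2)⁻¹ • G + b q)) = b.coord p z - x := by
      have h2 : z - (x • (‖G‖ ^ 2)⁻¹ • G + b q) = (z - b q) - (x * (‖G‖ ^ 2)⁻¹) • G := by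
        rw [smul_smul]; abel
      rw [h2, inner_sub_right, b.coord_sub_coord, b.coord_apply_ne hq.symm, inner_smul_right,
        real_inner_self_eq_norm_sq]
      field_simp
      ring
    rw [h1]
    simp [hG0, sub_eq_zero]
  have hTm : MeasurableSet T := b.isCompact_convexHull.measurableSet
  have hslice := EuclideanGeometry.euclideanHausdorffMeasure_eq_lintegral (b q) hv0 hTm
  simp only [finrank_euclideanSpace, Fintype.card_fin, Nat.add_sub_cancel, hplane] at hslice
  rw [EuclideanSpace.euclideanHausdorffMeasure_eq_volume] at hslice
  have hae : (fun x : ℝ => (Measure.euclideanHausdorffMeasure n : Measure (EuclideanSpace ℝ (Fin (n + 1))))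
        (T ∩ {z | b.coord p z = x})) =ᵐ[volume]
      (Set.Ico (0 : ℝ) 1).indicator fun x => ENNReal.ofReal ((1 - x) ^ n) *
        Measure.euclideanHausdorffMeasure n S := by
    -- At level 1 the slice is the vertex itself, which is not empty; a single level is negligible.
    have h1 : ∀ᵐ x : ℝ, x ≠ 1 := by simp [ae_iff]
    filter_upwards [h1] with x hx
    by_cases hI : x ∈ Set.Ico (0 : ℝ) 1
    · have h0 : 0 < 1 - x := by linarith [hI.2]
      rw [Set.indicator_of_mem hI, b.convexHull_inter_coord_eq p hI,
        euclideanHausdorffMeasure_homothety_image _ _ h0.ne', ENNReal.smul_def, smul_eq_mul]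
      congr 1
      rw [ENNReal.ofReal, Real.toNNReal_pow h0.le, Real.toNNReal_eq_nnnorm_of_nonneg h0.le]
    · rw [Set.indicator_of_notMem hI]
      suffices h : T ∩ {z | b.coord p z = x} = ∅ by rw [h, measure_empty]
      rw [Set.eq_empty_iff_forall_notMem]
      rintro z ⟨hz, rfl⟩
      rw [hT, b.convexHull_eq_nonneg_coord] at hz
      refine hI ⟨hz p, lt_of_le_of_ne ?_ hx⟩
      rw [← b.sum_coord_apply_eq_one z]
      exact Finset.single_le_sum (f := fun i => b.coord i z) (fun i _ => hz i) (Finset.mem_univ p)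
  rw [lintegral_congr_ae hae, lintegral_indicator measurableSet_Ico,
    lintegral_mul_const _ (by fun_prop), lintegral_one_sub_pow] at hslice
  have hreal := congrArg ENNReal.toReal hslice
  rw [ENNReal.toReal_mul, ENNReal.toReal_mul, toReal_enorm, ENNReal.toReal_ofReal (by positivity),
    hv, norm_smul] at hreal
  simp only [Measure.real]
  rw [hreal, norm_inv, norm_pow, norm_norm]
  field_simp

/-! ### Mean values on lower-dimensional simplices -/

section Surface

variable {E : Type*} [NormedAddCommGroup E] [InnerProductSpace ℝ E] [MeasurableSpace E]
  [BorelSpace E]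

omit [MeasurableSpace E] [BorelSpace E] in
/-- An affinely independent set of `n + 1` points is an isometric image of an affine basis of
`n`-dimensional Euclidean space. -/
theorem exists_affineIsometry_affineBasis {n : ℕ} {S : Finset E}
    (hS : AffineIndependent ℝ ((↑) : S → E)) (hn : S.card = n + 1) :
    ∃ (e : EuclideanSpace ℝ (Fin n) →ᵃⁱ[ℝ] E) (b : AffineBasis S ℝ (EuclideanSpace ℝ (Fin n))),
      ∀ p : S, e (b p) = p := by
  have hne : Nonempty S := by
    rw [Finset.nonempty_coe_sort, ← Finset.card_pos]; omega
  obtain ⟨p₀⟩ := hne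
  have hc : Fintype.card S = n + 1 := by simpa using hn
  have hfr := hS.finrank_vectorSpan hc
  set V := vectorSpan ℝ (Set.range ((↑) : S → E)) with hV
  have hfin : FiniteDimensional ℝ V :=
    finiteDimensional_vectorSpan_of_finite ℝ (Set.finite_range _)
  -- An orthonormal basis of the direction space gives coordinates; `e` then translates the origin
  -- to the vertex `p₀`.
  let iso : V ≃ₗᵢ[ℝ] EuclideanSpace ℝ (Fin n) := (stdOrthonormalBasis ℝ V).reindex
    (finCongr hfr) |>.repr
  let e : EuclideanSpace ℝ (Fin n) →ᵃⁱ[ℝ] E :=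
    (AffineIsometryEquiv.constVAdd ℝ E (p₀ : E)).toAffineIsometry.comp
      (V.subtypeₗᵢ.comp iso.symm.toLinearIsometry).toAffineIsometry
  let f : S → EuclideanSpace ℝ (Fin n) := fun p =>
    iso ⟨(p : E) - p₀, vsub_mem_vectorSpan ℝ (Set.mem_range_self p) (Set.mem_range_self p₀)⟩
  have hef : ∀ p : S, e (f p) = p := fun p => by
    simp [e, f]
  have hind : AffineIndependent ℝ f := by
    refine AffineIndependent.of_comp e.toAffineMap ?_
    have h : e.toAffineMap ∘ f = ((↑) : S → E) := funext hef
    rw [h]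
    exact hS
  refine ⟨e, ⟨f, hind, ?_⟩, hef⟩
  rw [hind.affineSpan_eq_top_iff_card_eq_finrank_add_one]
  simpa using hn

omit [MeasurableSpace E] [BorelSpace E] in
/-- A simplex is the image of a reference simplex. -/
theorem convexHull_eq_image_of_affineIsometry {ι F : Type*} [NormedAddCommGroup F]
    [NormedSpace ℝ F] {S : Set E} {g : ι → E} (hg : Set.range g = S) (e : F →ᵃⁱ[ℝ] E) {b : ι → F}
    (hb : ∀ p, e (b p) = g p) : convexHull ℝ S = e '' convexHull ℝ (Set.range b) := by
  have h := AffineMap.image_convexHull e.toAffineMap (Set.range b)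
  rw [AffineIsometry.coe_toAffineMap] at h
  have hcomp : e ∘ b = g := funext hb
  rw [h, ← Set.range_comp, hcomp, hg]

/-- The mean value of an affine function on an `n`-simplex with respect to the `n`-dimensional
Hausdorff measure is the mean of its vertex values. -/
theorem setAverage_affineMap_surface {n : ℕ} {S : Finset E}
    (hS : AffineIndependent ℝ ((↑) : S → E)) (hn : S.card = n + 1) (f : E →ᵃ[ℝ] ℝ) :
    ⨍ x in convexHull ℝ (S : Set E), f x ∂(Measure.euclideanHausdorffMeasure n) =
      (∑ p ∈ S, f p) / S.card := by
  obtain ⟨e, b, hb⟩ := exists_affineIsometry_affineBasis hS hn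
  have himg : convexHull ℝ (S : Set E) = e '' convexHull ℝ (Set.range b) :=
    convexHull_eq_image_of_affineIsometry Subtype.range_coe e hb
  have hemb : MeasurableEmbedding e := e.isometry.isClosedEmbedding.measurableEmbedding
  have hint : ∫ x in convexHull ℝ (S : Set E), f x ∂(Measure.euclideanHausdorffMeasure n) =
      ∫ x in convexHull ℝ (Set.range b), f (e x) := by
    rw [← EuclideanSpace.euclideanHausdorffMeasure_eq_volume]
    have h1 : (convexHull ℝ (S : Set E)) ⊆ Set.range e := himg ▸ Set.image_subset_range _ _
    have h2 : MeasurableSet (convexHull ℝ (S : Set E)) :=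
      (S.finite_toSet.isCompact_convexHull ℝ).measurableSet
    rw [← Set.inter_eq_left.2 h1, ← Measure.restrict_restrict h2,
      ← e.isometry.map_euclideanHausdorffMeasure, hemb.setIntegral_map, himg,
      Set.preimage_image_eq _ e.injective]
  have hmeas : (Measure.euclideanHausdorffMeasure n : Measure E).real (convexHull ℝ (S : Set E)) =
      volume.real (convexHull ℝ (Set.range b)) := by
    rw [Measure.real, himg, e.isometry.euclideanHausdorffMeasure_image,
      EuclideanSpace.euclideanHausdorffMeasure_eq_volume, Measure.real]
  have := b.setAverage_affineMap volume (f.comp e.toAffineMap)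
  rw [setAverage_eq] at this ⊢
  rw [hint, hmeas]
  refine this.trans ?_
  rw [Fintype.card_coe, ← Finset.sum_coe_sort S]
  congr 1
  exact Finset.sum_congr rfl fun p _ => by simp [hb]

end Surface

/-! ### The divergence theorem on one element -/

/-- The divergence theorem on a simplex for an affine function and a vector field with constant
normal components on the sides, in barycentric coordinates. -/
theorem AffineBasis.linear_average_add_trace_mul_average {ι : Type*} [Fintype ι] [DecidableEq ι]
    {d : ℕ} (b : AffineBasis ι ℝ (EuclideanSpace ℝ (Fin d)))
    (v : EuclideanSpace ℝ (Fin d) →ᵃ[ℝ] ℝ)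
    (y : EuclideanSpace ℝ (Fin d) →ᵃ[ℝ] EuclideanSpace ℝ (Fin d)) (Y : ι → ℝ)
    (hY : ∀ p q, q ≠ p → (b.coord p).linear (y (b q)) = Y p) :
    v.linear ((Fintype.card ι : ℝ)⁻¹ • ∑ i, y (b i)) +
        (∑ j, y.linear (EuclideanSpace.single j 1) j) * ((∑ i, v (b i)) / Fintype.card ι) =
      -∑ p, Y p * ((∑ r, v (b r)) - v (b p)) := by
  have hN : (Fintype.card ι : ℝ) ≠ 0 := by
    have := b.nonempty
    exact_mod_cast Fintype.card_ne_zero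
  -- The hypothesis gives the off-diagonal entries. The gradients of all coordinates sum to zero, so
  -- each column does too, which determines the diagonal.
  have ha : ∀ p q, (b.coord p).linear (y (b q)) = Y p - if p = q then ∑ i, Y i else 0 := by
    intro p q
    by_cases h : p = q
    · subst h
      have h1 := b.sum_coord_linear (y (b p))
      rw [← Finset.add_sum_erase _ _ (Finset.mem_univ p)] at h1
      rw [Finset.sum_congr rfl fun i hi => hY i p (Finset.ne_of_mem_erase hi).symm] at h1
      have h2 := Finset.add_sum_erase _ Y (Finset.mem_univ p)
      simp only [if_true]
      linarith
    · rw [hY p q (Ne.symm h), if_neg h, sub_zero]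
  have hv : v.linear ((Fintype.card ι : ℝ)⁻¹ • ∑ i, y (b i)) =
      (∑ p, Y p * v (b p)) - (∑ i, Y i) * ((∑ i, v (b i)) / Fintype.card ι) := by
    rw [map_smul, b.affineMap_linear_eq_sum v]
    simp only [map_sum, ha, Finset.sum_sub_distrib, Finset.sum_ite_eq, Finset.mem_univ, if_true,
      Finset.sum_const, Finset.card_univ, nsmul_eq_mul, smul_eq_mul, sub_mul, mul_sub]
    rw [← Finset.mul_sum]
    simp only [mul_assoc]
    rw [← Finset.mul_sum]
    field_simp
  -- The divergence is the trace of the linear part, hence the sum of the diagonal entries `Y i - ∑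
  -- Y`.
  have hdiv : ∑ j, y.linear (EuclideanSpace.single j 1) j =
      (1 - Fintype.card ι) * ∑ i, Y i := by
    have h1 : ∀ j, y.linear (EuclideanSpace.single j 1) j =
        ∑ i, (b.coord i).linear (EuclideanSpace.single j 1) * y (b i) j := fun j => by
      rw [b.affineMap_linear_eq_sum y]
      simp
    have h2 : ∀ i, ∑ j, (b.coord i).linear (EuclideanSpace.single j 1) * y (b i) j =
        (b.coord i).linear (y (b i)) := fun i => by
      conv_rhs => rw [← (EuclideanSpace.basisFun (Fin d) ℝ).sum_repr (y (b i)), map_sum]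
      exact Finset.sum_congr rfl fun j _ => by simp [mul_comm]
    rw [Finset.sum_congr rfl fun j _ => h1 j, Finset.sum_comm,
      Finset.sum_congr rfl fun i _ => h2 i]
    simp only [ha, if_true, Finset.sum_sub_distrib, Finset.sum_const, Finset.card_univ,
      nsmul_eq_mul]
    ring
  rw [hv, hdiv]
  simp only [mul_sub, Finset.sum_sub_distrib, ← Finset.sum_mul]
  field_simp
  ring

namespace CRRT.Triangulation

variable {d : ℕ} {Ω : Set (Pt d)} (𝒯 : Triangulation Ω)

/-- The vertices of an element as an affine basis. -/
noncomputable def basis (T : 𝒯.Elem) : AffineBasis T.1 ℝ (Pt d) where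
  toFun := (↑)
  ind' := 𝒯.complex.indep T.2.1
  tot' := by
    rw [(𝒯.complex.indep T.2.1).affineSpan_eq_top_iff_card_eq_finrank_add_one]
    simpa using T.2.2

@[simp] theorem basis_apply (T : 𝒯.Elem) (p : T.1) : 𝒯.basis T p = p := rfl

theorem range_basis (T : 𝒯.Elem) : Set.range (𝒯.basis T) = (T.1 : Set (Pt d)) :=
  Subtype.range_coe

theorem hull_elem (T : 𝒯.Elem) : hull T.1 = convexHull ℝ (Set.range (𝒯.basis T)) := by
  rw [range_basis, hull]

theorem mem_hull_subset_iff (T : 𝒯.Elem) {S : Finset (Pt d)} (hS : S ⊆ T.1) (x : Pt d) :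
    x ∈ hull S ↔ (∀ i : T.1, 0 ≤ (𝒯.basis T).coord i x) ∧
      ∀ i : T.1, (i : Pt d) ∉ S → (𝒯.basis T).coord i x = 0 := by
  have h : (S : Set (Pt d)) = 𝒯.basis T '' {i : T.1 | (i : Pt d) ∈ S} := by
    ext p
    constructor
    · exact fun hp => ⟨⟨p, hS hp⟩, hp, rfl⟩
    · rintro ⟨i, hi, rfl⟩
      exact hi
  rw [hull, h, (𝒯.basis T).mem_convexHull_image_iff]
  rfl

theorem side_eq_erase {T : 𝒯.Elem} {S : 𝒯.Side} (h : S.1 ⊆ T.1) :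
    ∃ p : T.1, (p : Pt d) ∉ S.1 ∧ ∀ q : T.1, (q : Pt d) ∈ S.1 ↔ q ≠ p := by
  classical
  have hc : (T.1 \ S.1).card = 1 := by
    rw [Finset.card_sdiff_of_subset h, T.2.2, S.2.2]; omega
  obtain ⟨p, hp⟩ := Finset.card_eq_one.1 hc
  have hpm : p ∈ T.1 \ S.1 := by simp [hp]
  rw [Finset.mem_sdiff] at hpm
  refine ⟨⟨p, hpm.1⟩, hpm.2, fun q => ⟨?_, fun hq => ?_⟩⟩
  · rintro hq rfl
    exact hpm.2 hq
  · by_contra hqS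
    have : (q : Pt d) ∈ T.1 \ S.1 := Finset.mem_sdiff.2 ⟨q.2, hqS⟩
    rw [hp, Finset.mem_singleton] at this
    exact hq (Subtype.ext this)

variable {𝒯}

theorem nontrivial_elem (hd : 0 < d) (T : 𝒯.Elem) : Nontrivial T.1 := by
  rw [← Fintype.one_lt_card_iff_nontrivial, Fintype.card_coe, T.2.2]
  omega

/-- The outward unit normal is the normalized negative gradient of the barycentric coordinate of
the opposite vertex. -/
theorem outerNormal_eq (hd : 0 < d) {T : 𝒯.Elem} {S : 𝒯.Side} {p : T.1}
    (hp : ∀ q : T.1, (q : Pt d) ∈ S.1 ↔ q ≠ p) (hST : S.1 ⊆ T.1) :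
    outerNormal T.1 S.1 = -(‖(𝒯.basis T).gradCoord p‖⁻¹ • (𝒯.basis T).gradCoord p) := by
  have := nontrivial_elem hd T
  set b := 𝒯.basis T with hb
  set G := b.gradCoord p with hG
  have hG0 : ‖G‖ ≠ 0 := norm_ne_zero_iff.2 (b.gradCoord_ne_zero p)
  have hdiff : ∀ q r : T.1, inner ℝ G ((q : Pt d) - r) = b.coord p q - b.coord p r := fun q r =>
    b.coord_sub_coord p q r
  have hS0 : ∀ q : T.1, (q : Pt d) ∈ S.1 → b.coord p q = 0 := fun q hq =>
    b.coord_apply_ne ((hp q).1 hq).symm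
  have hp1 : b.coord p p = 1 := b.coord_apply_eq p
  -- Existence of one normal makes the choice in `outerNormal` meaningful; the rest of the proof is
  -- uniqueness.
  have hex : IsOuterNormal T.1 S.1 (-(‖G‖⁻¹ • G)) := by
    refine ⟨by rw [norm_neg, norm_smul, norm_inv, norm_norm, inv_mul_cancel₀ hG0], ?_, ?_⟩
    · intro q hq r hr
      have h := hdiff ⟨q, hST hq⟩ ⟨r, hST hr⟩
      rw [hS0 ⟨q, hST hq⟩ hq, hS0 ⟨r, hST hr⟩ hr] at h
      rw [inner_neg_left, inner_smul_left, h]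
      simp
    · intro q hq hqS r hr
      have hqp : (⟨q, hq⟩ : T.1) = p := by
        by_contra hne
        exact hqS ((hp ⟨q, hq⟩).2 hne)
      have h := hdiff ⟨q, hq⟩ ⟨r, hST hr⟩
      rw [hS0 ⟨r, hST hr⟩ hr, hqp, hp1] at h
      rw [inner_neg_left, inner_smul_left]
      subst hqp
      rw [h]
      simp only [map_inv₀, conj_trivial, sub_zero, mul_one]
      have : 0 < ‖G‖⁻¹ := by positivity
      linarith
  have hm : IsOuterNormal T.1 S.1 (outerNormal T.1 S.1) := Classical.epsilon_spec ⟨_, hex⟩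
  set m := outerNormal T.1 S.1
  obtain ⟨q, hq⟩ := exists_ne p
  have hqS := (hp q).2 hq
  -- An outer normal `m` has the same inner product with all vertices of the side, and `κ` is the
  -- drop from there to `p`. Expanding in the vertices gives `m = -κ ∇λ_p`, and the unit length
  -- fixes `κ`.
  set κ : ℝ := -inner ℝ m ((p : Pt d) - q) with hκ
  have hκ0 : 0 < κ := by
    have := hm.outward p p.2 (fun h => (hp p).1 h rfl) q hqS
    rw [hκ]; linarith
  have hmG : m = -(κ • G) := by
    refine ext_inner_right ℝ fun w => ?_
    have h1 := b.affineMap_linear_eq_sum (innerₛₗ ℝ m).toAffineMap w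
    have h2 : ∀ i : T.1, i ≠ p → inner ℝ m (i : Pt d) = inner ℝ m (q : Pt d) := fun i hi => by
      have := hm.orthogonal i ((hp i).2 hi) q hqS
      rw [inner_sub_right] at this
      linarith
    have h3 := b.sum_coord_linear w
    have h4 : inner ℝ m w = ∑ i, (b.coord i).linear w * inner ℝ m (i : Pt d) := h1
    rw [h4, inner_neg_left, inner_smul_left, b.inner_gradCoord]
    classical
    rw [← Finset.add_sum_erase _ _ (Finset.mem_univ p)] at h3 ⊢
    rw [Finset.sum_congr rfl fun i hi => by rw [h2 i (Finset.ne_of_mem_erase hi)],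
      ← Finset.sum_mul, hκ, inner_sub_right]
    have h5 : ∑ i ∈ Finset.univ.erase p, (b.coord i).linear w = -(b.coord p).linear w := by
      linarith
    rw [h5]
    simp only [conj_trivial]
    ring
  have hn := hm.norm_eq
  rw [hmG, norm_neg, norm_smul, Real.norm_of_nonneg hκ0.le] at hn
  rw [hmG, eq_inv_of_mul_eq_one_left hn]

/-- The divergence theorem on an element: the sum over the sides of the element. -/
theorem volume_mul_eq_sum_sides [Fintype 𝒯.Side] [DecidableEq (Pt d)] (hd : 0 < d) (T : 𝒯.Elem)
    (v : Pt d →ᵃ[ℝ] ℝ) (y : Pt d →ᵃ[ℝ] Pt d)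
    (hy : ∀ S : 𝒯.Side, S.1 ⊆ T.1 →
      ∃ c : ℝ, ∀ x ∈ hull S.1, inner ℝ (y x) (outerNormal T.1 S.1) = c) :
    volume.real (hull T.1) *
        ((∑ j, v.linear (EuclideanSpace.single j 1) * ⨍ x in hull T.1, y x j) +
          (∑ j, y.linear (EuclideanSpace.single j 1) j) * ⨍ x in hull T.1, v x) =
      ∑ S : 𝒯.Side with S.1 ⊆ T.1, (surf d).real (hull S.1) *
        (inner ℝ (y (S.1.centroid ℝ id)) (outerNormal T.1 S.1) *
          ⨍ x in hull S.1, v x ∂(surf d)) := by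
  obtain ⟨n, rfl⟩ : ∃ n, d = n + 1 := ⟨d - 1, by omega⟩
  have := nontrivial_elem hd T
  set b := 𝒯.basis T with hb
  let E : T.1 → 𝒯.Side := fun p => ⟨T.1.erase p, 𝒯.complex.down_closed T.2.1
    (Finset.erase_subset _ _) (Finset.card_pos.1 (by
      rw [Finset.card_erase_of_mem p.2, T.2.2]; omega)), by
      rw [Finset.card_erase_of_mem p.2, T.2.2]; omega⟩
  have hET : ∀ p, (E p).1 ⊆ T.1 := fun p => Finset.erase_subset _ _
  have hE : ∀ p q : T.1, (q : Pt (n + 1)) ∈ (E p).1 ↔ q ≠ p := fun p q => by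
    change (q : Pt (n + 1)) ∈ T.1.erase p ↔ q ≠ p
    rw [Finset.mem_erase]
    exact ⟨fun h e => h.1 (congrArg _ e), fun h => ⟨fun e => h (Subtype.ext e), q.2⟩⟩
  choose c hc using fun p => hy (E p) (hET p)
  -- Since `∇λ_p` is `-|∇λ_p|` times the normal, constant normal components are constant derivatives
  -- of `λ_p` along `y`.
  have hY : ∀ p q, q ≠ p → (b.coord p).linear (y (b q)) = -(‖b.gradCoord p‖ * c p) := by
    intro p q hqp
    have h1 := hc p q (subset_convexHull ℝ _ ((hE p q).2 hqp))
    have hG0 : ‖b.gradCoord p‖ ≠ 0 := norm_ne_zero_iff.2 (b.gradCoord_ne_zero p)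
    have ho : outerNormal T.1 (E p).1 = -(‖b.gradCoord p‖⁻¹ • b.gradCoord p) :=
      outerNormal_eq hd (hE p) (hET p)
    rw [ho, inner_neg_right, inner_smul_right, real_inner_comm, b.inner_gradCoord] at h1
    rw [← h1, mul_neg, neg_neg, ← mul_assoc, mul_inv_cancel₀ hG0, one_mul]
    rfl
  have hmean : ∀ f : Pt (n + 1) →ᵃ[ℝ] ℝ,
      ⨍ x in hull T.1, f x = (∑ i, f (b i)) / Fintype.card T.1 := fun f => by
    rw [𝒯.hull_elem, b.setAverage_affineMap volume]
  have hgrad : ∑ j, v.linear (EuclideanSpace.single j 1) * ⨍ x in hull T.1, y x j =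
      v.linear ((Fintype.card T.1 : ℝ)⁻¹ • ∑ i, y (b i)) := by
    have h1 : ∀ j, ⨍ x in hull T.1, y x j =
        ((Fintype.card T.1 : ℝ)⁻¹ • ∑ i, y (b i)) j := fun j => by
      have h2 : ⨍ x in hull T.1, y x j = (∑ i, y (b i) j) / Fintype.card T.1 :=
        hmean ((EuclideanSpace.proj (𝕜 := ℝ) j).toLinearMap.toAffineMap.comp y)
      rw [h2, div_eq_inv_mul]
      simp
    conv_rhs => rw [← (EuclideanSpace.basisFun (Fin (n + 1)) ℝ).sum_repr
      ((Fintype.card T.1 : ℝ)⁻¹ • ∑ i, y (b i)), map_sum]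
    refine Finset.sum_congr rfl fun j _ => ?_
    rw [h1, map_smul, smul_eq_mul, mul_comm, EuclideanSpace.basisFun_repr,
      EuclideanSpace.basisFun_apply]
  rw [hgrad, hmean v, b.linear_average_add_trace_mul_average v y _ hY, ← Finset.sum_neg_distrib,
    Finset.mul_sum]
  -- The sides of an element are indexed by their opposite vertices.
  refine Finset.sum_bij (fun p _ => E p) (fun p _ => by simp [hET]) (fun p _ q _ h => ?_)
    (fun S hS => ?_) (fun p _ => ?_)
  · by_contra hpq
    have h1 := (hE p q).2 (Ne.symm hpq)
    rw [h, hE] at h1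
    exact h1 rfl
  · obtain ⟨p, -, hp⟩ := 𝒯.side_eq_erase (T := T) (S := S) (by simpa using hS)
    refine ⟨p, Finset.mem_univ _, Subtype.ext (Finset.ext fun q => ?_)⟩
    constructor
    · intro hq
      exact (hp ⟨q, hET p hq⟩).2 ((hE p ⟨q, hET p hq⟩).1 hq)
    · intro hq
      have hqT : q ∈ T.1 := (Finset.mem_filter.1 hS).2 hq
      exact (hE p ⟨q, hqT⟩).2 ((hp ⟨q, hqT⟩).1 hq)
  · have hne : (E p).1.Nonempty := Finset.card_pos.1 (by rw [(E p).2.2]; omega)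
    rw [hc p _ (Finset.centroid_mem_convexHull (R := ℝ) _ hne)]
    have himg : hull (E p).1 = convexHull ℝ (b '' {p}ᶜ) := by
      ext x
      rw [𝒯.mem_hull_subset_iff T (hET p), b.mem_convexHull_image_iff]
      simp [hE, hb]
    -- The factor `n + 1` in the area cancels the number of vertices in the mean over the side.
    have hsurf : (surf (n + 1)).real (hull (E p).1) =
        (n + 1) * ‖b.gradCoord p‖ * volume.real (hull T.1) := by
      rw [himg, 𝒯.hull_elem T]
      exact b.surface_eq p
    have havg : ⨍ x in hull (E p).1, v x ∂(surf (n + 1)) =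
        ((∑ r, v (b r)) - v (b p)) / (n + 1) := by
      have h1 := setAverage_affineMap_surface (𝒯.complex.indep (E p).2.1) (E p).2.2 v
      rw [(E p).2.2] at h1
      refine h1.trans ?_
      congr 1
      · rw [eq_sub_iff_add_eq]
        exact (Finset.sum_erase_add T.1 v p.2).trans (Finset.sum_coe_sort T.1 v).symm
      · push_cast; rfl
    rw [hsurf, havg]
    field_simp

end CRRT.Triangulation

/-! ### Geometry of the triangulation: inner and boundary sides -/

namespace CRRT.Triangulation

variable {d : ℕ} {Ω : Set (Pt d)} {𝒯 : Triangulation Ω}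

theorem elemOf_subset (S : 𝒯.Side) : S.1 ⊆ (𝒯.elemOf S).1 :=
  (𝒯.pure S.1 S.2.1).choose_spec.2.1

theorem elem_eq_of_subset {T T' : 𝒯.Elem} (h : T.1 ⊆ T'.1) : T = T' :=
  Subtype.ext (Finset.eq_of_subset_of_card_le h (by rw [T.2.2, T'.2.2]))

theorem isCompact_hull (s : Finset (Pt d)) : IsCompact (hull s) :=
  s.finite_toSet.isCompact_convexHull ℝ

theorem mem_hull_elem_iff (T : 𝒯.Elem) (x : Pt d) :
    x ∈ hull T.1 ↔ ∀ i : T.1, 0 ≤ (𝒯.basis T).coord i x := by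
  rw [𝒯.hull_elem, (𝒯.basis T).convexHull_eq_nonneg_coord]
  rfl

theorem mem_interior_hull_elem_iff (T : 𝒯.Elem) (x : Pt d) :
    x ∈ interior (hull T.1) ↔ ∀ i : T.1, 0 < (𝒯.basis T).coord i x := by
  rw [𝒯.hull_elem, (𝒯.basis T).interior_convexHull]
  rfl

theorem continuous_coord (T : 𝒯.Elem) (i : T.1) : Continuous ((𝒯.basis T).coord i) :=
  ((𝒯.basis T).coord i).continuous_of_finiteDimensional

/-- Barycentric coordinates of vertices that are not shared vanish on the intersection. -/
theorem coord_eq_zero_of_mem_hull {T T' : 𝒯.Elem} {x : Pt d} (hx : x ∈ hull T.1)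
    (hx' : x ∈ hull T'.1) (p : T.1) (hp : (p : Pt d) ∉ T'.1) : (𝒯.basis T).coord p x = 0 := by
  classical
  have h : x ∈ hull (T.1 ∩ T'.1) := by
    have := 𝒯.complex.inter_subset_convexHull T.2.1 T'.2.1 ⟨hx, hx'⟩
    rwa [← Finset.coe_inter] at this
  exact ((𝒯.mem_hull_subset_iff T Finset.inter_subset_left x).1 h).2 p fun hm =>
    hp (Finset.mem_inter.1 hm).2

/-- Some vertex of `T` is missing from `T'`. By conformity its coordinate vanishes on the
intersection, whereas interior points have only positive coordinates. -/
theorem disjoint_interior_hull {T T' : 𝒯.Elem} (h : T ≠ T') :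
    Disjoint (interior (hull T.1)) (interior (hull T'.1)) := by
  rw [Set.disjoint_left]
  intro x hx hx'
  obtain ⟨p, hp, hp'⟩ : ∃ p ∈ T.1, p ∉ T'.1 := by
    by_contra! hsub
    exact h (elem_eq_of_subset hsub)
  have h1 := coord_eq_zero_of_mem_hull (interior_subset hx) (interior_subset hx') ⟨p, hp⟩ hp'
  exact ((mem_interior_hull_elem_iff T x).1 hx ⟨p, hp⟩).ne' h1

theorem closure_eq_iUnion_hull : closure Ω = ⋃ T : 𝒯.Elem, hull T.1 := by
  rw [← 𝒯.space_eq]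
  ext x
  rw [SimplicialComplex.mem_space_iff, Set.mem_iUnion]
  constructor
  · rintro ⟨s, hs, hx⟩
    obtain ⟨t, ht, hst, hc⟩ := 𝒯.pure s hs
    exact ⟨⟨t, ht, hc⟩, convexHull_mono (Finset.coe_subset.2 hst) hx⟩
  · rintro ⟨T, hx⟩
    exact ⟨T.1, T.2.1, hx⟩

theorem hull_subset_closure (T : 𝒯.Elem) : hull T.1 ⊆ closure Ω := by
  rw [closure_eq_iUnion_hull (𝒯 := 𝒯)]
  exact Set.subset_iUnion (fun T : 𝒯.Elem => hull T.1) T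

theorem interior_hull_subset (hΩ : interior (closure Ω) = Ω) (T : 𝒯.Elem) :
    interior (hull T.1) ⊆ Ω :=
  (interior_mono (hull_subset_closure T)).trans hΩ.le

/-- A side has a point in its relative interior with positive barycentric coordinates. -/
theorem exists_mem_relint (hd : 0 < d) (S : 𝒯.Side) :
    ∃ c ∈ relint S.1, c ∈ hull S.1 ∧ ∀ (T : 𝒯.Elem) (q : T.1), S.1 ⊆ T.1 → (q : Pt d) ∈ S.1 →
      0 < (𝒯.basis T).coord q c := by
  obtain ⟨n, rfl⟩ : ∃ n, d = n + 1 := ⟨d - 1, by omega⟩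
  obtain ⟨e, b, hb⟩ := exists_affineIsometry_affineBasis (𝒯.complex.indep S.2.1) S.2.2
  obtain ⟨x, hx⟩ : (interior (convexHull ℝ (Set.range b))).Nonempty :=
    ⟨_, b.centroid_mem_interior_convexHull⟩
  have himg : hull S.1 = e '' convexHull ℝ (Set.range b) :=
    convexHull_eq_image_of_affineIsometry Subtype.range_coe e hb
  refine ⟨e x, ?_, himg ▸ Set.mem_image_of_mem e (interior_subset hx), fun T q hST hq => ?_⟩
  · rw [relint, himg, AffineIsometry.intrinsicInterior_image]
    exact Set.mem_image_of_mem e (interior_subset_intrinsicInterior hx)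
  -- Pulled back to the reference simplex of `S`, the coordinate of `T` at `q` has the vertex values
  -- of the coordinate of `S` at `q`, so the two agree.
  · have h1 := b.affineMap_apply_eq_sum (((𝒯.basis T).coord q).comp e.toAffineMap) x
    have h2 : ∀ i : S.1, (((𝒯.basis T).coord q).comp e.toAffineMap) (b i) =
        if i = ⟨q, hq⟩ then 1 else 0 := fun i => by
      rw [AffineMap.comp_apply, AffineIsometry.coe_toAffineMap, hb]
      split_ifs with h
      · subst h
        exact (𝒯.basis T).coord_apply_eq q
      · refine (𝒯.basis T).coord_apply_ne (j := ⟨i, hST i.2⟩) fun h3 => h ?_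
        exact Subtype.ext (congrArg (fun r : T.1 => (r : Pt (n + 1))) h3).symm
    rw [Finset.sum_congr rfl fun i _ => by rw [h2 i]] at h1
    simp only [smul_eq_mul, mul_ite, mul_one, mul_zero, Finset.sum_ite_eq', Finset.mem_univ,
      if_true] at h1
    have h3 : 0 < b.coord ⟨q, hq⟩ x := by
      rw [b.interior_convexHull] at hx
      exact hx _
    rw [← h1] at h3
    exact h3

section TwoElements

variable {S : 𝒯.Side} {T T' : 𝒯.Elem} {p : T.1} {p' : T'.1}

theorem notMem_of_ne (hT : T ≠ T') (hS' : S.1 ⊆ T'.1)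
    (hp : ∀ q : T.1, (q : Pt d) ∈ S.1 ↔ q ≠ p) : (p : Pt d) ∉ T'.1 := fun h =>
  hT (elem_eq_of_subset fun q hq => by
    by_cases hqp : (⟨q, hq⟩ : T.1) = p
    · rwa [← hqp] at h
    · exact hS' ((hp ⟨q, hq⟩).2 hqp))

/-- Two elements with a common side lie on opposite sides of it. -/
theorem coord_opposite_neg (hd : 0 < d) (hT : T ≠ T') (hS : S.1 ⊆ T.1) (hS' : S.1 ⊆ T'.1)
    (hp : ∀ q : T.1, (q : Pt d) ∈ S.1 ↔ q ≠ p) (hp' : ∀ q : T'.1, (q : Pt d) ∈ S.1 ↔ q ≠ p') :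
    (𝒯.basis T).coord p p' < 0 := by
  by_contra! hneg
  obtain ⟨c, -, hcS, hc⟩ := exists_mem_relint hd S
  have hc0 : (𝒯.basis T).coord p c = 0 :=
    ((𝒯.mem_hull_subset_iff T hS c).1 hcS).2 p fun h => (hp p).1 h rfl
  have hc0' : (𝒯.basis T').coord p' c = 0 :=
    ((𝒯.mem_hull_subset_iff T' hS' c).1 hcS).2 p' fun h => (hp' p').1 h rfl
  have hline : ∀ (T₀ : 𝒯.Elem) (q : T₀.1) (t : ℝ), (𝒯.basis T₀).coord q
      (AffineMap.lineMap c (p' : Pt d) t) =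
      (1 - t) * (𝒯.basis T₀).coord q c + t * (𝒯.basis T₀).coord q p' := fun T₀ q t => by
    rw [AffineMap.apply_lineMap, AffineMap.lineMap_apply]
    simp only [vsub_eq_sub, smul_eq_mul, vadd_eq_add]
    ring
  -- If `p'` were not strictly beyond the side, the segment from `c` to `p'` would start inside both
  -- elements. Conformity would then make the coordinate of `p'` vanish there, but it equals `t >
  -- 0`.
  have hev : ∀ᶠ t in nhdsWithin (0 : ℝ) (Set.Ioo 0 1),
      AffineMap.lineMap c (p' : Pt d) t ∈ hull T.1 := by
    simp only [mem_hull_elem_iff]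
    rw [Filter.eventually_all]
    intro q
    by_cases hq : q = p
    · filter_upwards [self_mem_nhdsWithin] with t ht
      rw [hline, hq, hc0, mul_zero, zero_add]
      exact mul_nonneg ht.1.le hneg
    · have hcont : Continuous fun t : ℝ => (𝒯.basis T).coord q (AffineMap.lineMap c (p' : Pt d) t) :=
        (continuous_coord T q).comp AffineMap.lineMap_continuous
      have h1 := (hcont.tendsto 0).eventually (lt_mem_nhds (a := 0) (by
        rw [AffineMap.lineMap_apply_zero]
        exact hc T q hS ((hp q).2 hq)))
      exact (h1.filter_mono nhdsWithin_le_nhds).mono fun t ht => ht.le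
  have hne : (nhdsWithin (0 : ℝ) (Set.Ioo 0 1)).NeBot := left_nhdsWithin_Ioo_neBot zero_lt_one
  obtain ⟨t, ht, ht0⟩ := (hev.and self_mem_nhdsWithin).exists
  have hmem' : AffineMap.lineMap c (p' : Pt d) t ∈ hull T'.1 :=
    (convex_convexHull ℝ _).lineMap_mem (convexHull_mono (Finset.coe_subset.2 hS') hcS)
      (subset_convexHull ℝ _ p'.2) ⟨ht0.1.le, ht0.2.le⟩
  have h0 := coord_eq_zero_of_mem_hull hmem' ht p' (notMem_of_ne hT.symm hS hp')
  have h1 : (𝒯.basis T').coord p' p' = 1 := (𝒯.basis T').coord_apply_eq p'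
  rw [hline, hc0', h1] at h0
  linarith [ht0.1]

/-- The barycentric coordinates that vanish on a common side are proportional. -/
theorem coord_eq_mul_coord (hS : S.1 ⊆ T.1)
    (hp : ∀ q : T.1, (q : Pt d) ∈ S.1 ↔ q ≠ p) (hp' : ∀ q : T'.1, (q : Pt d) ∈ S.1 ↔ q ≠ p')
    (x : Pt d) :
    (𝒯.basis T).coord p x = (𝒯.basis T').coord p' x * (𝒯.basis T).coord p p' := by
  rw [(𝒯.basis T').affineMap_apply_eq_sum ((𝒯.basis T).coord p) x, Finset.sum_eq_single p']
  · rfl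
  · intro q _ hq
    have hqS := (hp' q).2 hq
    have : (𝒯.basis T).coord p q = 0 :=
      (𝒯.basis T).coord_apply_ne (j := ⟨q, hS hqS⟩) ((hp ⟨q, hS hqS⟩).1 hqS).symm
    rw [basis_apply, this, smul_zero]
  · simp

/-- Near `c` the coordinates at the vertices of `S` stay positive in both elements. The sign of the
remaining coordinate of `T` decides which of the two contains the point, so together they cover a
neighbourhood. -/
theorem mem_interior_of_two_elements (hd : 0 < d) (hT : T ≠ T') (hS : S.1 ⊆ T.1)
    (hS' : S.1 ⊆ T'.1) {c : Pt d}
    (hc : ∀ (T : 𝒯.Elem) (q : T.1), S.1 ⊆ T.1 → (q : Pt d) ∈ S.1 → 0 < (𝒯.basis T).coord q c) :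
    c ∈ interior (closure Ω) := by
  obtain ⟨p, -, hp⟩ := 𝒯.side_eq_erase hS
  obtain ⟨p', -, hp'⟩ := 𝒯.side_eq_erase hS'
  have hneg := coord_opposite_neg hd hT hS hS' hp hp'
  have hpos : ∀ (T₀ : 𝒯.Elem), S.1 ⊆ T₀.1 → ∀ᶠ z in nhds c, ∀ q : T₀.1, (q : Pt d) ∈ S.1 →
      0 < (𝒯.basis T₀).coord q z := fun T₀ h₀ => by
    rw [Filter.eventually_all]
    intro q
    by_cases hq : (q : Pt d) ∈ S.1
    · exact (((continuous_coord T₀ q).tendsto c).eventually (lt_mem_nhds (hc T₀ q h₀ hq))).mono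
        fun z hz _ => hz
    · exact Filter.Eventually.of_forall fun z h => absurd h hq
  rw [mem_interior_iff_mem_nhds]
  filter_upwards [hpos T hS, hpos T' hS'] with z hz hz'
  by_cases h0 : 0 ≤ (𝒯.basis T).coord p z
  · refine hull_subset_closure T ((mem_hull_elem_iff T z).2 fun q => ?_)
    by_cases hq : q = p
    · rwa [hq]
    · exact (hz q ((hp q).2 hq)).le
  · refine hull_subset_closure T' ((mem_hull_elem_iff T' z).2 fun q => ?_)
    by_cases hq : q = p'
    · rw [coord_eq_mul_coord hS hp hp'] at h0
      by_contra! h1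
      rw [hq] at h1
      exact h0 (mul_nonneg_of_nonpos_of_nonpos h1.le hneg.le)
    · exact (hz' q ((hp' q).2 hq)).le

/-- A side belongs to at most two elements. -/
theorem eq_or_eq_of_subset (hd : 0 < d) (hT : T ≠ T') (hS : S.1 ⊆ T.1) (hS' : S.1 ⊆ T'.1)
    {T'' : 𝒯.Elem} (hS'' : S.1 ⊆ T''.1) : T'' = T ∨ T'' = T' := by
  by_contra! h
  obtain ⟨p, -, hp⟩ := 𝒯.side_eq_erase hS
  obtain ⟨p', -, hp'⟩ := 𝒯.side_eq_erase hS'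
  obtain ⟨p'', -, hp''⟩ := 𝒯.side_eq_erase hS''
  have h1 := coord_opposite_neg hd hT hS hS' hp hp'
  have h2 := coord_opposite_neg hd h.1.symm hS hS'' hp hp''
  have h3 := coord_opposite_neg hd h.2.symm hS' hS'' hp' hp''
  -- Three elements would lie pairwise on opposite sides of `S`: one negative number would be a
  -- product of two negative ones.
  rw [coord_eq_mul_coord hS hp hp'] at h2
  exact absurd h2 (mul_nonneg_of_nonpos_of_nonpos h3.le h1.le).not_gt

end TwoElements

/-- A side of only one element lies in the boundary. -/
theorem hull_subset_frontier (hd : 0 < d) (hΩ : interior (closure Ω) = Ω) {S : 𝒯.Side}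
    {T : 𝒯.Elem} (hS : S.1 ⊆ T.1) (huniq : ∀ T' : 𝒯.Elem, S.1 ⊆ T'.1 → T' = T) :
    hull S.1 ⊆ frontier Ω := by
  obtain ⟨p, -, hp⟩ := 𝒯.side_eq_erase hS
  have hopen : IsOpen Ω := hΩ ▸ isOpen_interior
  have key : ∀ x ∈ hull S.1, (∀ q : T.1, (q : Pt d) ∈ S.1 → 0 < (𝒯.basis T).coord q x) →
      x ∈ frontier Ω := by
    intro x hxS hx
    have hxT : x ∈ hull T.1 := convexHull_mono (Finset.coe_subset.2 hS) hxS
    rw [hopen.frontier_eq]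
    refine ⟨hull_subset_closure T hxT, fun hxΩ => ?_⟩
    have hx0 : (𝒯.basis T).coord p x = 0 :=
      ((𝒯.mem_hull_subset_iff T hS x).1 hxS).2 p fun h => (hp p).1 h rfl
    set A : Set (Pt d) := ⋃ T' : {T' : 𝒯.Elem // T' ≠ T}, hull T'.1.1 with hA
    have hAc : IsClosed A := isClosed_iUnion_of_finite fun T' => (isCompact_hull _).isClosed
    have htend : Filter.Tendsto (fun t : ℝ => AffineMap.lineMap x (p : Pt d) t)
        (nhdsWithin 0 (Set.Iio 0)) (nhds x) := by
      have h1 : Continuous fun t : ℝ => AffineMap.lineMap x (p : Pt d) t :=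
        AffineMap.lineMap_continuous
      have h2 := h1.tendsto 0
      rw [AffineMap.lineMap_apply_zero] at h2
      exact h2.mono_left nhdsWithin_le_nhds
    -- Moving from `x` away from `p` leaves `T` at once. If `x` were in `Ω`, nearby points would be
    -- covered by other elements; closedness puts `x` in one of these, and positivity of its
    -- coordinates gives that element all of `S`, against uniqueness.
    have hxA : x ∈ A := by
      refine hAc.mem_of_tendsto htend ?_
      filter_upwards [htend.eventually (hopen.mem_nhds hxΩ), self_mem_nhdsWithin] with t ht ht0
      have h1 := subset_closure ht
      rw [closure_eq_iUnion_hull (𝒯 := 𝒯), Set.mem_iUnion] at h1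
      obtain ⟨T', hT'⟩ := h1
      refine Set.mem_iUnion.2 ⟨⟨T', ?_⟩, hT'⟩
      rintro rfl
      have h2 := (mem_hull_elem_iff T' _).1 hT' p
      have h3 : (𝒯.basis T').coord p p = 1 := (𝒯.basis T').coord_apply_eq p
      rw [AffineMap.apply_lineMap, AffineMap.lineMap_apply, hx0, h3] at h2
      simp only [vsub_eq_sub, sub_zero, smul_eq_mul, mul_one, vadd_eq_add, add_zero] at h2
      exact absurd h2 (not_le.2 ht0)
    obtain ⟨⟨T', hne⟩, hT'⟩ := Set.mem_iUnion.1 hxA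
    refine hne (huniq T' fun q hq => ?_)
    by_contra hqT'
    exact (hx ⟨q, hS hq⟩ hq).ne' (coord_eq_zero_of_mem_hull hxT hT' ⟨q, hS hq⟩ hqT')
  -- Every point of the side is a limit of points with positive coordinates, and the boundary is
  -- closed.
  obtain ⟨c, -, hcS, hc⟩ := exists_mem_relint hd S
  intro y hy
  have h1 : Continuous fun t : ℝ => AffineMap.lineMap y c t := AffineMap.lineMap_continuous
  have h2 := h1.tendsto 0
  rw [AffineMap.lineMap_apply_zero] at h2
  have hne : (nhdsWithin (0 : ℝ) (Set.Ioo 0 1)).NeBot := left_nhdsWithin_Ioo_neBot zero_lt_one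
  refine isClosed_frontier.mem_of_tendsto
    (h2.mono_left (nhdsWithin_le_nhds (s := Set.Ioo (0 : ℝ) 1))) ?_
  filter_upwards [self_mem_nhdsWithin] with t ht
  refine key _ ((convex_convexHull ℝ _).lineMap_mem hy hcS ⟨ht.1.le, ht.2.le⟩) fun q hq => ?_
  rw [AffineMap.apply_lineMap, AffineMap.lineMap_apply]
  simp only [vsub_eq_sub, smul_eq_mul, vadd_eq_add]
  have h3 := hc T q hS hq
  have h4 := ((𝒯.mem_hull_subset_iff T hS y).1 hy).1 q
  nlinarith [ht.1, ht.2, mul_pos ht.1 h3, mul_nonneg (sub_nonneg.2 ht.2.le) h4]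

open Classical in
/-- Contributions of inner sides cancel; the boundary sides remain. -/
theorem sum_elem_of_side (hd : 0 < d) (hΩ : interior (closure Ω) = Ω) {ΓD ΓN : Set (Pt d)}
    (hdisj : Disjoint ΓD ΓN) (hunion : ΓD ∪ ΓN = frontier Ω)
    (hresolve : ∀ S : 𝒯.Side, hull S.1 ⊆ frontier Ω → relint S.1 ⊆ ΓD ∨ relint S.1 ⊆ ΓN)
    (S : 𝒯.Side) (F : 𝒯.Elem → ℝ)
    (hF : ∀ T T' : 𝒯.Elem, T ≠ T' → S.1 ⊆ T.1 → S.1 ⊆ T'.1 → F T + F T' = 0) :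
    ∑ T : 𝒯.Elem with S.1 ⊆ T.1, F T =
      (if relint S.1 ⊆ ΓD then F (𝒯.elemOf S) else 0) +
        (if relint S.1 ⊆ ΓN then F (𝒯.elemOf S) else 0) := by
  have hopen : IsOpen Ω := hΩ ▸ isOpen_interior
  have hS := elemOf_subset S
  obtain ⟨c, hcr, -, hc⟩ := exists_mem_relint hd S
  by_cases h : ∃ T' : 𝒯.Elem, S.1 ⊆ T'.1 ∧ T' ≠ 𝒯.elemOf S
  · obtain ⟨T', hS', hne⟩ := h
    have hcΩ : c ∈ Ω := hΩ ▸ mem_interior_of_two_elements hd hne hS' hS hc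
    -- A relative interior point of an inner side lies in the open set `Ω`, so the side is counted
    -- neither in `ΓD` nor in `ΓN`.
    have hcf : c ∉ frontier Ω := fun h => (hopen.frontier_eq ▸ h).2 hcΩ
    have hD : ¬ relint S.1 ⊆ ΓD := fun h => hcf (hunion ▸ Or.inl (h hcr))
    have hN : ¬ relint S.1 ⊆ ΓN := fun h => hcf (hunion ▸ Or.inr (h hcr))
    rw [if_neg hD, if_neg hN]
    have hset : (Finset.univ.filter fun T : 𝒯.Elem => S.1 ⊆ T.1) = {T', 𝒯.elemOf S} := by
      ext T
      simp only [Finset.mem_filter, Finset.mem_univ, true_and, Finset.mem_insert,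
        Finset.mem_singleton]
      refine ⟨eq_or_eq_of_subset hd hne hS' hS, ?_⟩
      rintro (rfl | rfl)
      exacts [hS', hS]
    rw [hset, Finset.sum_pair hne, hF _ _ hne hS' hS, add_zero]
  · push Not at h
    have hset : (Finset.univ.filter fun T : 𝒯.Elem => S.1 ⊆ T.1) = {𝒯.elemOf S} := by
      ext T
      simp only [Finset.mem_filter, Finset.mem_univ, true_and, Finset.mem_singleton]
      refine ⟨h T, ?_⟩
      rintro rfl
      exact hS
    rw [hset, Finset.sum_singleton]
    rcases hresolve S (hull_subset_frontier hd hΩ hS h) with hD | hN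
    · have hN : ¬ relint S.1 ⊆ ΓN := fun hN => Set.disjoint_left.1 hdisj (hD hcr) (hN hcr)
      rw [if_pos hD, if_neg hN, add_zero]
    · have hD : ¬ relint S.1 ⊆ ΓD := fun hD => Set.disjoint_left.1 hdisj (hD hcr) (hN hcr)
      rw [if_pos hN, if_neg hD, zero_add]

end CRRT.Triangulation

/-! ### Integrals of element-wise constant functions as weighted sums -/

namespace CRRT

/-- `I` is the sum `∑ w T * a T`, where `a T` may take the value `⊤`. -/
def IsWeightedSum {τ : Type*} [Fintype τ] (w : τ → ℝ) (a : τ → EReal) (I : EReal) : Prop :=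
  (∃ r : τ → ℝ, (∀ T, a T = r T) ∧ I = ((∑ T, w T * r T : ℝ) : EReal)) ∨
    ((∃ T, a T = ⊤) ∧ I = ⊤)

theorem IsWeightedSum.ne_bot {τ : Type*} [Fintype τ] {w : τ → ℝ} {a : τ → EReal} {I : EReal}
    (h : IsWeightedSum w a I) : I ≠ ⊥ := by
  rcases h with ⟨r, -, rfl⟩ | ⟨-, rfl⟩
  · exact EReal.coe_ne_bot _
  · exact top_ne_bot

theorem IsWeightedSum.exists_of_ne_top {τ : Type*} [Fintype τ] {w : τ → ℝ} {a : τ → EReal}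
    {I : EReal} (h : IsWeightedSum w a I) (hI : I ≠ ⊤) :
    ∃ r : τ → ℝ, (∀ T, a T = r T) ∧ I = ((∑ T, w T * r T : ℝ) : EReal) :=
  h.resolve_right fun h' => hI h'.2

theorem IsWeightedSum.exists_of_forall_ne_top {τ : Type*} [Fintype τ] {w : τ → ℝ} {a : τ → EReal}
    {I : EReal} (h : IsWeightedSum w a I) (ha : ∀ T, a T ≠ ⊤) :
    ∃ r : τ → ℝ, (∀ T, a T = r T) ∧ I = ((∑ T, w T * r T : ℝ) : EReal) :=
  h.resolve_right fun h' => h'.1.elim fun T hT => ha T hT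

namespace Triangulation

variable {d : ℕ} {Ω : Set (Pt d)} {𝒯 : Triangulation Ω}

theorem piecewise_eq {F : Type*} [AddCommMonoid F] (c : 𝒯.Elem → F) {T : 𝒯.Elem} {x : Pt d}
    (hx : x ∈ interior (hull T.1)) : 𝒯.piecewise c x = c T := by
  rw [piecewise, Finset.sum_eq_single T]
  · exact Set.indicator_of_mem hx _
  · intro T' _ hne
    exact Set.indicator_of_notMem
      (fun h => Set.disjoint_left.1 (disjoint_interior_hull hne) h hx) _
  · simp

theorem volume_frontier_hull (s : Finset (Pt d)) : volume (frontier (hull s)) = 0 :=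
  (convex_convexHull ℝ (s : Set (Pt d))).addHaar_frontier volume

theorem volume_interior_hull (T : 𝒯.Elem) : volume (interior (hull T.1)) = volume (hull T.1) := by
  refine le_antisymm (measure_mono interior_subset) ?_
  calc volume (hull T.1) ≤ volume (interior (hull T.1) ∪ frontier (hull T.1)) :=
        measure_mono (by
          rw [← closure_eq_interior_union_frontier]; exact subset_closure)
    _ ≤ volume (interior (hull T.1)) + volume (frontier (hull T.1)) := measure_union_le _ _
    _ = volume (interior (hull T.1)) := by
        rw [volume_frontier_hull, add_zero]

theorem volume_hull_pos (T : 𝒯.Elem) : 0 < volume (hull T.1) := by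
  rw [𝒯.hull_elem]
  exact (𝒯.basis T).measure_convexHull_pos volume

theorem volume_real_hull_pos (T : 𝒯.Elem) : 0 < volume.real (hull T.1) :=
  ENNReal.toReal_pos (volume_hull_pos T).ne' (isCompact_hull T.1).measure_lt_top.ne

/-- The simplices cover `Ω`, and their boundaries are null sets because simplices are convex. -/
theorem restrict_eq_restrict_iUnion (hΩ : interior (closure Ω) = Ω) :
    (volume : Measure (Pt d)).restrict Ω =
      volume.restrict (⋃ T : 𝒯.Elem, interior (hull T.1)) := by
  refine Measure.restrict_congr_set (Filter.EventuallyLE.antisymm ?_ ?_)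
  · rw [ae_le_set]
    refine measure_mono_null (t := ⋃ T : 𝒯.Elem, frontier (hull T.1)) ?_
      (measure_iUnion_null fun T =>
        volume_frontier_hull T.1)
    rintro x ⟨hx, hxn⟩
    have h1 := subset_closure hx
    rw [closure_eq_iUnion_hull (𝒯 := 𝒯), Set.mem_iUnion] at h1
    obtain ⟨T, hT⟩ := h1
    exact Set.mem_iUnion.2 ⟨T, subset_closure hT, fun h => hxn (Set.mem_iUnion.2 ⟨T, h⟩)⟩
  · exact (Set.iUnion_subset fun T => interior_hull_subset hΩ T).eventuallyLE

theorem ae_restrict_iff_forall_elem (hΩ : interior (closure Ω) = Ω) {P : Pt d → Prop}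
    {Q : 𝒯.Elem → Prop}
    (hPQ : ∀ T : 𝒯.Elem, ∀ᵐ x ∂(volume.restrict (interior (hull T.1))), P x ↔ Q T) :
    (∀ᵐ x ∂(volume.restrict Ω), P x) ↔ ∀ T, Q T := by
  rw [restrict_eq_restrict_iUnion (𝒯 := 𝒯) hΩ, ae_restrict_iUnion_iff]
  refine forall_congr' fun T => ⟨fun h => ?_, fun h => (hPQ T).mono fun x hx => hx.2 h⟩
  -- An element has positive volume, so a property valid almost everywhere holds at some point of
  -- it, and one point suffices for a constant.
  have hne : (ae ((volume : Measure (Pt d)).restrict (interior (hull T.1)))).NeBot := by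
    rw [ae_neBot, Ne, Measure.restrict_eq_zero, volume_interior_hull]
    exact (volume_hull_pos T).ne'
  obtain ⟨x, hx, hx'⟩ := (h.and (hPQ T)).exists
  exact hx'.1 hx

theorem lintegral_eq_sum (hΩ : interior (closure Ω) = Ω) {f : Pt d → ENNReal}
    {a : 𝒯.Elem → ENNReal}
    (hf : ∀ T : 𝒯.Elem, ∀ᵐ x ∂(volume.restrict (interior (hull T.1))), f x = a T) :
    ∫⁻ x in Ω, f x = ∑ T, a T * volume (hull T.1) := by
  rw [restrict_eq_restrict_iUnion (𝒯 := 𝒯) hΩ, lintegral_iUnion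
    (fun T => isOpen_interior.measurableSet) (fun T T' h => disjoint_interior_hull h),
    tsum_fintype]
  refine Finset.sum_congr rfl fun T _ => ?_
  rw [lintegral_congr_ae (hf T), setLIntegral_const, volume_interior_hull]

/-- Excluding `⊥` makes the integral of the negative part finite, so `⊤ - ⊤` cannot occur. A single
value `⊤` makes the whole integral `⊤`, since elements have positive volume. -/
theorem isWeightedSum_eintegral (hΩ : interior (closure Ω) = Ω) {f : Pt d → EReal}
    {a : 𝒯.Elem → EReal} (ha : ∀ T, a T ≠ ⊥)
    (hf : ∀ T : 𝒯.Elem, ∀ᵐ x ∂(volume.restrict (interior (hull T.1))), f x = a T) :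
    IsWeightedSum (fun T : 𝒯.Elem => volume.real (hull T.1)) a
      (eintegral (volume.restrict Ω) f) := by
  have h1 := lintegral_eq_sum hΩ (f := fun x => (f x).toENNReal)
    (a := fun T => (a T).toENNReal) fun T => (hf T).mono fun x hx => by rw [hx]
  have h2 := lintegral_eq_sum hΩ (f := fun x => (-f x).toENNReal)
    (a := fun T => (-a T).toENNReal) fun T => (hf T).mono fun x hx => by rw [hx]
  have hfin : ∀ T : 𝒯.Elem, volume (hull T.1) ≠ ⊤ := fun T =>
    (isCompact_hull T.1).measure_lt_top.ne
  have hneg : ∑ T, (-a T).toENNReal * volume (hull T.1) ≠ ⊤ := by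
    refine ENNReal.sum_ne_top.2 fun T _ => ENNReal.mul_ne_top ?_ (hfin T)
    rw [Ne, EReal.toENNReal_eq_top_iff, EReal.neg_eq_top_iff]
    exact ha T
  rw [eintegral, h1, h2]
  by_cases htop : ∃ T, a T = ⊤
  · refine Or.inr ⟨htop, ?_⟩
    obtain ⟨T, hT⟩ := htop
    have h3 : ∑ T, (a T).toENNReal * volume (hull T.1) = ⊤ := by
      refine ENNReal.sum_eq_top.2 ⟨T, Finset.mem_univ _, ?_⟩
      rw [hT, EReal.toENNReal_top, ENNReal.top_mul (volume_hull_pos T).ne']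
    rw [h3]
    lift ∑ T, (-a T).toENNReal * volume (hull T.1) to NNReal using hneg with n
    rw [EReal.coe_ennreal_top, EReal.coe_nnreal_eq_coe_real, EReal.top_sub_coe]
  · push Not at htop
    left
    lift a to 𝒯.Elem → ℝ using fun T => ⟨htop T, ha T⟩ with r
    refine ⟨r, fun T => rfl, ?_⟩
    have hconv : ∀ s : 𝒯.Elem → ℝ,
        ((∑ T, ((s T : ℝ) : EReal).toENNReal * volume (hull T.1) : ENNReal) : EReal) =
          ((∑ T, max (s T) 0 * volume.real (hull T.1) : ℝ) : EReal) := fun s => by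
      have h3 : ∑ T, ((s T : ℝ) : EReal).toENNReal * volume (hull T.1) =
          ENNReal.ofReal (∑ T, max (s T) 0 * volume.real (hull T.1)) := by
        rw [ENNReal.ofReal_sum_of_nonneg fun T _ =>
          mul_nonneg (le_max_right _ _) (volume_real_hull_pos T).le]
        refine Finset.sum_congr rfl fun T _ => ?_
        rw [ENNReal.ofReal_mul (le_max_right _ _), Measure.real, ENNReal.ofReal_toReal (hfin T),
          EReal.toENNReal_of_ne_top (EReal.coe_ne_top _), EReal.toReal_coe]
        congr 1
        rcases le_total (s T) 0 with h | h
        · rw [max_eq_right h, ENNReal.ofReal_of_nonpos h, ENNReal.ofReal_zero]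
        · rw [max_eq_left h]
      rw [h3, EReal.coe_ennreal_ofReal, max_eq_left]
      exact Finset.sum_nonneg fun T _ => mul_nonneg (le_max_right _ _) (volume_real_hull_pos T).le
    have h4 := hconv fun T => -r T
    simp only [EReal.coe_neg] at h4
    rw [hconv r, h4, ← EReal.coe_sub, ← Finset.sum_sub_distrib]
    congr 1
    refine Finset.sum_congr rfl fun T _ => ?_
    rw [← sub_mul, mul_comm]
    congr 1
    rcases le_total (r T) 0 with h | h
    · rw [max_eq_right h, max_eq_left (by linarith)]; ring
    · rw [max_eq_left h, max_eq_right (by linarith)]; ring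

end Triangulation

/-! ### Weak and strong duality for finite sums -/

section Duality

variable {τ : Type*} [Fintype τ] {w : τ → ℝ} {a b α β : τ → EReal} {p q : τ → ℝ}
  {I₁ I₂ J₁ J₂ i j : EReal} {s t : ℝ}

/-- The weak duality inequality for weighted sums with Fenchel–Young summands. -/
theorem dual_le_primal (hw : ∀ T, 0 ≤ w T)
    (hI₁ : IsWeightedSum w a I₁) (hI₂ : IsWeightedSum w b I₂)
    (hJ₁ : IsWeightedSum w α J₁) (hJ₂ : IsWeightedSum w β J₂)
    (hp : ∀ T, (p T : EReal) ≤ α T + a T) (hq : ∀ T, (q T : EReal) ≤ β T + b T)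
    (hi : i = 0 ∨ i = ⊤) (hj : j = 0 ∨ j = ⊤)
    (hst : i = 0 → j = 0 → ∑ T, w T * (p T + q T) = s + t) :
    -J₁ - J₂ + (t : EReal) - j ≤ I₁ + I₂ - (s : EReal) + i := by
  -- If the dual indicator or a conjugate integral is `⊤`, the left side is `⊥`, which absorbs in
  -- sums of extended reals.
  rcases hj with rfl | rfl
  swap
  · simp [sub_eq_add_neg]
  rcases hJ₁ with ⟨r₁, hα, rfl⟩ | ⟨-, rfl⟩
  swap
  · simp [sub_eq_add_neg]
  rcases hJ₂ with ⟨r₂, hβ, rfl⟩ | ⟨-, rfl⟩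
  swap
  · simp [sub_eq_add_neg]
  have hs : (-(s : EReal)) ≠ ⊥ := EReal.coe_ne_bot (-s)
  rcases hi with rfl | rfl
  swap
  · rw [EReal.add_top_of_ne_bot]
    · exact le_top
    · rw [sub_eq_add_neg, Ne, EReal.add_eq_bot_iff, EReal.add_eq_bot_iff]
      simp [hI₁.ne_bot, hI₂.ne_bot, hs]
  by_cases h₁ : I₁ = ⊤
  · rw [h₁, EReal.top_add_of_ne_bot hI₂.ne_bot, EReal.top_sub_coe]
    simp
  by_cases h₂ : I₂ = ⊤
  · rw [h₂, EReal.add_top_of_ne_bot hI₁.ne_bot, EReal.top_sub_coe]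
    simp
  obtain ⟨r₃, ha, rfl⟩ := hI₁.exists_of_ne_top h₁
  obtain ⟨r₄, hb, rfl⟩ := hI₂.exists_of_ne_top h₂
  have hsum : s + t ≤ ∑ T, w T * ((r₁ T + r₃ T) + (r₂ T + r₄ T)) := by
    rw [← hst rfl rfl]
    refine Finset.sum_le_sum fun T _ => mul_le_mul_of_nonneg_left (add_le_add ?_ ?_) (hw T)
    · have := hp T
      rw [hα, ha] at this
      exact_mod_cast this
    · have := hq T
      rw [hβ, hb] at this
      exact_mod_cast this
  simp only [mul_add, Finset.sum_add_distrib] at hsum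
  rw [sub_zero, add_zero]
  have : -(∑ T, w T * r₁ T) - (∑ T, w T * r₂ T) + t ≤
      (∑ T, w T * r₃ T) + (∑ T, w T * r₄ T) - s := by linarith
  exact_mod_cast this

/-- Strong duality holds if and only if all Fenchel–Young inequalities are equalities. -/
theorem primal_eq_dual_iff (hw : ∀ T, 0 < w T)
    (hI₁ : IsWeightedSum w a I₁) (hI₂ : IsWeightedSum w b I₂)
    (hJ₁ : IsWeightedSum w α J₁) (hJ₂ : IsWeightedSum w β J₂)
    (ha : ∀ T, a T ≠ ⊥) (hb : ∀ T, b T ≠ ⊥) (hα : ∀ T, α T ≠ ⊥) (hβ : ∀ T, β T ≠ ⊥)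
    (hp : ∀ T, (p T : EReal) ≤ α T + a T) (hq : ∀ T, (q T : EReal) ≤ β T + b T)
    (hst : ∑ T, w T * (p T + q T) = s + t) :
    I₁ + I₂ - (s : EReal) + 0 = -J₁ - J₂ + (t : EReal) - 0 ↔
      (∀ T, (p T : EReal) = α T + a T) ∧ ∀ T, (q T : EReal) = β T + b T := by
  rw [sub_zero, add_zero]
  have hs : (-(s : EReal)) ≠ ⊥ := EReal.coe_ne_bot (-s)
  have key : ∀ r₁ r₂ r₃ r₄ : τ → ℝ, (∀ T, α T = r₁ T) → (∀ T, β T = r₂ T) → (∀ T, a T = r₃ T) →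
      (∀ T, b T = r₄ T) →
      ((((∑ T, w T * r₃ T : ℝ) : EReal) + ((∑ T, w T * r₄ T : ℝ) : EReal) - (s : EReal) =
        -((∑ T, w T * r₁ T : ℝ) : EReal) - ((∑ T, w T * r₂ T : ℝ) : EReal) + (t : EReal)) ↔
      (∀ T, (p T : EReal) = α T + a T) ∧ ∀ T, (q T : EReal) = β T + b T) := by
    intro r₁ r₂ r₃ r₄ h₁ h₂ h₃ h₄
    have hp' : ∀ T, p T ≤ r₁ T + r₃ T := fun T => by
      have := hp T
      rw [h₁, h₃] at this
      exact_mod_cast this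
    have hq' : ∀ T, q T ≤ r₂ T + r₄ T := fun T => by
      have := hq T
      rw [h₂, h₄] at this
      exact_mod_cast this
    have hl : (((∑ T, w T * r₃ T : ℝ) : EReal) + ((∑ T, w T * r₄ T : ℝ) : EReal) - (s : EReal) =
        -((∑ T, w T * r₁ T : ℝ) : EReal) - ((∑ T, w T * r₂ T : ℝ) : EReal) + (t : EReal)) ↔
        (∑ T, w T * r₃ T) + (∑ T, w T * r₄ T) - s =
          -(∑ T, w T * r₁ T) - (∑ T, w T * r₂ T) + t := by norm_cast
    -- By the integration by parts identity `hst`, the difference of the two values is the weighted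
    -- sum of the Fenchel–Young gaps.
    have hz : ((∑ T, w T * r₃ T) + (∑ T, w T * r₄ T) - s =
          -(∑ T, w T * r₁ T) - (∑ T, w T * r₂ T) + t) ↔
        ∑ T, w T * ((r₁ T + r₃ T - p T) + (r₂ T + r₄ T - q T)) = 0 := by
      simp only [mul_add, mul_sub, Finset.sum_add_distrib, Finset.sum_sub_distrib] at hst ⊢
      constructor <;> intro h <;> linarith
    rw [hl, hz, Finset.sum_eq_zero_iff_of_nonneg fun T _ => mul_nonneg (hw T).le
      (add_nonneg (sub_nonneg.2 (hp' T)) (sub_nonneg.2 (hq' T))), ← forall_and]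
    refine forall_congr' fun T => ?_
    rw [h₁, h₂, h₃, h₄]
    simp only [Finset.mem_univ, true_imp_iff, mul_eq_zero, (hw T).ne', false_or]
    have e₁ : ((p T : EReal) = r₁ T + r₃ T) ↔ p T = r₁ T + r₃ T := by norm_cast
    have e₂ : ((q T : EReal) = r₂ T + r₄ T) ↔ q T = r₂ T + r₄ T := by norm_cast
    rw [e₁, e₂]
    have := hp' T
    have := hq' T
    constructor
    · intro h
      constructor <;> linarith
    · rintro ⟨h, h'⟩
      rw [h, h']
      ring
  constructor
  · intro h
    have hprim : ∀ {x y : EReal}, x ≠ ⊥ → y ≠ ⊥ → x + y - (s : EReal) ≠ ⊥ := fun hx hy => by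
      rw [sub_eq_add_neg, Ne, EReal.add_eq_bot_iff, EReal.add_eq_bot_iff]
      simp [hx, hy, hs]
    -- The primal side is never `⊥`, so equality makes the conjugate integrals finite; the dual side
    -- is then real, and so are the primal integrals.
    rcases hJ₁ with ⟨r₁, h₁, rfl⟩ | ⟨-, rfl⟩
    swap
    · exact absurd (h.trans (by simp [sub_eq_add_neg])) (hprim hI₁.ne_bot hI₂.ne_bot)
    rcases hJ₂ with ⟨r₂, h₂, rfl⟩ | ⟨-, rfl⟩
    swap
    · exact absurd (h.trans (by simp [sub_eq_add_neg])) (hprim hI₁.ne_bot hI₂.ne_bot)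
    have hdual : -((∑ T, w T * r₁ T : ℝ) : EReal) - ((∑ T, w T * r₂ T : ℝ) : EReal) +
        (t : EReal) ≠ ⊤ := by
      exact_mod_cast EReal.coe_ne_top (-(∑ T, w T * r₁ T) - (∑ T, w T * r₂ T) + t)
    rw [← h] at hdual
    obtain ⟨r₃, h₃, rfl⟩ := hI₁.exists_of_ne_top (by
      rintro rfl
      rw [EReal.top_add_of_ne_bot hI₂.ne_bot, sub_eq_add_neg, EReal.top_add_of_ne_bot hs] at hdual
      exact hdual rfl)
    obtain ⟨r₄, h₄, rfl⟩ := hI₂.exists_of_ne_top (by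
      rintro rfl
      rw [EReal.add_top_of_ne_bot hI₁.ne_bot, sub_eq_add_neg, EReal.top_add_of_ne_bot hs] at hdual
      exact hdual rfl)
    exact (key r₁ r₂ r₃ r₄ h₁ h₂ h₃ h₄).1 h
  · rintro ⟨h, h'⟩
    -- Conversely, equality with a real number forces both summands to be finite on every element.
    have hfin : ∀ {x y : EReal} {c : ℝ}, (c : EReal) = x + y → x ≠ ⊥ → y ≠ ⊥ → x ≠ ⊤ ∧ y ≠ ⊤ := by
      intro x y c hc hx hy
      constructor
      · rintro rfl
        rw [EReal.top_add_of_ne_bot hy] at hc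
        exact EReal.coe_ne_top _ hc
      · rintro rfl
        rw [EReal.add_top_of_ne_bot hx] at hc
        exact EReal.coe_ne_top _ hc
    obtain ⟨r₁, h₁, rfl⟩ := hJ₁.exists_of_forall_ne_top fun T => (hfin (h T) (hα T) (ha T)).1
    obtain ⟨r₂, h₂, rfl⟩ := hJ₂.exists_of_forall_ne_top fun T => (hfin (h' T) (hβ T) (hb T)).1
    obtain ⟨r₃, h₃, rfl⟩ := hI₁.exists_of_forall_ne_top fun T => (hfin (h T) (hα T) (ha T)).2
    obtain ⟨r₄, h₄, rfl⟩ := hI₂.exists_of_forall_ne_top fun T => (hfin (h' T) (hβ T) (hb T)).2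
    exact (key r₁ r₂ r₃ r₄ h₁ h₂ h₃ h₄).2 ⟨h, h'⟩

end Duality

end CRRT

/-! ### Conjugates, discrete integration by parts and the theorem -/

namespace CRRT

section Conjugate

variable {V : Type*} {f : V → EReal}

theorem conj_ne_bot (B : V → V → ℝ) (hf : IsProper f) (s : V) : conj B f s ≠ ⊥ := by
  obtain ⟨hbot, r, hr⟩ := hf
  have h : ((B s r : ℝ) : EReal) - f r ≤ conj B f s :=
    le_iSup (fun r => ((B s r : ℝ) : EReal) - f r) r
  lift f r to ℝ using ⟨hr, hbot r⟩ with c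
  rw [← EReal.coe_sub] at h
  exact ne_bot_of_le_ne_bot (EReal.coe_ne_bot _) h

/-- The Fenchel–Young inequality. -/
theorem le_conj_add (B : V → V → ℝ) (hf : IsProper f) (s r : V) :
    ((B s r : ℝ) : EReal) ≤ conj B f s + f r := by
  have h : ((B s r : ℝ) : EReal) - f r ≤ conj B f s :=
    le_iSup (fun r => ((B s r : ℝ) : EReal) - f r) r
  refine (EReal.sub_le_iff_le_add (Or.inl (hf.1 r)) (Or.inr (conj_ne_bot B hf s))).1 h

end Conjugate

namespace Triangulation

variable {d ℓ : ℕ} {Ω ΓD ΓN : Set (Pt d)} {𝒯 : Triangulation Ω}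

theorem sum_sideOn [Fintype 𝒯.Side] (Γ : Set (Pt d))
    [DecidablePred fun S : 𝒯.Side => relint S.1 ⊆ Γ]
    (f : 𝒯.Side → ℝ) :
    ∑ S : 𝒯.SideOn Γ, f S.1 = ∑ S : 𝒯.Side, if relint S.1 ⊆ Γ then f S else 0 := by
  rw [← Finset.sum_filter]
  exact (Finset.sum_subtype _ (p := fun S : 𝒯.Side => relint S.1 ⊆ Γ) (by simp) f).symm

theorem side_nonempty (S : 𝒯.Side) : S.1.Nonempty :=
  𝒯.complex.nonempty_of_mem_faces S.2.1

/-- The vertex formula makes the mean additive on affine functions, so a jump of mean zero means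
equal means from both elements. -/
theorem sideAverage_eq_of_mem_CR (hd : 0 < d) {v : 𝒯.L1 ℝ} (hv : v ∈ 𝒯.CR) {S : 𝒯.Side}
    {T T' : 𝒯.Elem} (hT : T ≠ T') (hS : S.1 ⊆ T.1) (hS' : S.1 ⊆ T'.1) :
    ⨍ x in hull S.1, v T x ∂(surf d) = ⨍ x in hull S.1, v T' x ∂(surf d) := by
  have hcard : S.1.card = d - 1 + 1 := by rw [S.2.2]; omega
  have h : ∀ f : Pt d →ᵃ[ℝ] ℝ, ⨍ x in hull S.1, f x ∂(surf d) = (∑ p ∈ S.1, f p) / S.1.card :=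
    setAverage_affineMap_surface (𝒯.complex.indep S.2.1) hcard
  have h0 := hv S T T' hT hS hS'
  have h1 := h (v T - v T')
  simp only [AffineMap.coe_sub, Pi.sub_apply, Finset.sum_sub_distrib, sub_div] at h1
  rw [h0] at h1
  rw [h, h]
  linarith

/-- The discrete integration by parts formula for scalar Crouzeix–Raviart functions and
Raviart–Thomas vector fields. -/
theorem sum_volume_mul_eq_sum_boundary (hd : 0 < d) (hΩ : interior (closure Ω) = Ω)
    (hdisj : Disjoint ΓD ΓN) (hunion : ΓD ∪ ΓN = frontier Ω)
    (hresolve : ∀ S : 𝒯.Side, hull S.1 ⊆ frontier Ω → relint S.1 ⊆ ΓD ∨ relint S.1 ⊆ ΓN)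
    {v : 𝒯.L1 ℝ} (hv : v ∈ 𝒯.CR) {y : 𝒯.L1 (Pt d)} (hy : y ∈ 𝒯.RT)
    {B : 𝒯.Side → ℝ}
    (hB : ∀ S : 𝒯.Side, B S = (surf d).real (hull S.1) *
      (inner ℝ (y (𝒯.elemOf S) (S.1.centroid ℝ id)) (outerNormal (𝒯.elemOf S).1 S.1) *
          ⨍ x in hull S.1, v (𝒯.elemOf S) x ∂(surf d))) :
    ∑ T : 𝒯.Elem, volume.real (hull T.1) *
        ((∑ j, (v T).linear (EuclideanSpace.single j 1) * ⨍ x in hull T.1, y T x j) +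
          (∑ j, (y T).linear (EuclideanSpace.single j 1) j) * ⨍ x in hull T.1, v T x) =
      ∑ S : 𝒯.SideOn ΓD, B S.1 + ∑ S : 𝒯.SideOn ΓN, B S.1 := by
  classical
  have : Fintype 𝒯.Side := Fintype.ofFinite _
  rw [sum_sideOn ΓD B, sum_sideOn ΓN B, ← Finset.sum_add_distrib,
    Finset.sum_congr rfl fun T _ => volume_mul_eq_sum_sides hd T (v T) (y T) (hy.1 T)]
  simp only [Finset.sum_filter]
  rw [Finset.sum_comm]
  refine Finset.sum_congr rfl fun S _ => ?_
  rw [← Finset.sum_filter, sum_elem_of_side hd hΩ hdisj hunion hresolve S, ← hB]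
  intro T T' hT hS hS'
  -- The common mean of `v` factors out, and the normal components of `y` for the two opposite
  -- normals sum to zero at the centroid.
  rw [sideAverage_eq_of_mem_CR hd hv hT hS hS', ← mul_add, ← add_mul,
    hy.2 S T T' hT hS hS' _ (Finset.centroid_mem_convexHull (R := ℝ) _ (side_nonempty S))]
  simp

/-- The gradient on an element. -/
noncomputable def elemGrad (v : 𝒯.Ucr ℓ) (T : 𝒯.Elem) : Matrix (Fin ℓ) (Fin d) ℝ :=
  Matrix.of fun i j => (v.1 i T).linear (EuclideanSpace.single j 1)

/-- The mean value on an element. -/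
noncomputable def elemMean (v : 𝒯.Ucr ℓ) (T : 𝒯.Elem) : Fin ℓ → ℝ :=
  fun i => ⨍ x in hull T.1, v.1 i T x

/-- The mean value of a flux on an element. -/
noncomputable def elemFlux (y : 𝒯.Zrt ℓ) (T : 𝒯.Elem) : Matrix (Fin ℓ) (Fin d) ℝ :=
  Matrix.of fun i j => ⨍ x in hull T.1, y.1 i T x j

/-- The divergence on an element. -/
noncomputable def elemDiv (y : 𝒯.Zrt ℓ) (T : 𝒯.Elem) : Fin ℓ → ℝ :=
  fun i => ∑ j, (y.1 i T).linear (EuclideanSpace.single j 1) j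

/-- The discrete integration by parts formula. -/
theorem sum_frob_add_dot (hd : 0 < d) (hΩ : interior (closure Ω) = Ω)
    (hdisj : Disjoint ΓD ΓN) (hunion : ΓD ∪ ΓN = frontier Ω)
    (hresolve : ∀ S : 𝒯.Side, hull S.1 ⊆ frontier Ω → relint S.1 ⊆ ΓD ∨ relint S.1 ⊆ ΓN)
    (v : 𝒯.Ucr ℓ) (y : 𝒯.Zrt ℓ) :
    ∑ T : 𝒯.Elem, volume.real (hull T.1) *
        (frob (elemFlux y T) (elemGrad v T) + dot (elemDiv y T) (elemMean v T)) =
      𝒯.sidePairing (Γ := ΓN) (fun S => y.normalTrace S.1) (fun S => v.sideMean S.1) +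
        𝒯.sidePairing (Γ := ΓD) (fun S => y.normalTrace S.1) (fun S => v.sideMean S.1) := by
  have h := fun i => sum_volume_mul_eq_sum_boundary hd hΩ hdisj hunion hresolve (v.2 i) (y.2 i)
    (B := fun S => (surf d).real (hull S.1) * (y.normalTrace S i * v.sideMean S i)) fun S => rfl
  have h2 := Finset.sum_congr (rfl : (Finset.univ : Finset (Fin ℓ)) = _) fun i _ => h i
  have hpair : ∀ Γ : Set (Pt d), ∑ i, ∑ S : 𝒯.SideOn Γ,
      (surf d).real (hull S.1.1) * (y.normalTrace S.1 i * v.sideMean S.1 i) =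
        𝒯.sidePairing (Γ := Γ) (fun S => y.normalTrace S.1) (fun S => v.sideMean S.1) := fun Γ => by
    rw [Finset.sum_comm]
    exact Finset.sum_congr rfl fun S _ => (Finset.mul_sum _ _ _).symm
  rw [Finset.sum_comm, Finset.sum_add_distrib, hpair, hpair] at h2
  replace h2 := h2.trans (add_comm _ _)
  simp only [← Finset.mul_sum, Finset.sum_add_distrib] at h2
  refine Eq.trans (Finset.sum_congr rfl fun T _ => ?_) h2
  simp only [frob, dot, elemFlux, elemGrad, elemDiv, elemMean, Matrix.of_apply]
  congr 2
  exact Finset.sum_congr rfl fun i _ => Finset.sum_congr rfl fun j _ => mul_comm _ _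

theorem ae_eq_of_ae_eq_const {F : Type*} {f : Pt d → F} {c : F} {T : 𝒯.Elem}
    (h : ∀ᵐ x ∂(volume.restrict (hull T.1)), f x = c) :
    ∀ᵐ x ∂(volume.restrict (interior (hull T.1))), f x = c ∧ x ∈ interior (hull T.1) :=
  (h.filter_mono (ae_mono (Measure.restrict_mono interior_subset le_rfl))).and
    (ae_restrict_mem isOpen_interior.measurableSet)

/-- A property valid almost everywhere holds for the element-wise constant values. -/
theorem of_ae_restrict (hΩ : interior (closure Ω) = Ω) {F : Type*} {f : Pt d → F} {P : F → Prop}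
    (hP : ∀ᵐ x ∂(volume.restrict Ω), P (f x)) {c : 𝒯.Elem → F}
    (hc : ∀ T : 𝒯.Elem, ∀ᵐ x ∂(volume.restrict (hull T.1)), f x = c T) (T : 𝒯.Elem) : P (c T) :=
  (ae_restrict_iff_forall_elem hΩ (Q := fun T => P (c T))
    fun T => (ae_eq_of_ae_eq_const (hc T)).mono fun x hx => by rw [hx.1]).1 hP T

end Triangulation

end CRRT

open CRRT MeasureTheory in
theorem proposition3p4 {d ℓ : ℕ} (hd : 0 < d)
    {Ω ΓD ΓN : Set (Pt d)} (hΩ : interior (closure Ω) = Ω)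
    (hdisj : Disjoint ΓD ΓN) (hunion : ΓD ∪ ΓN = frontier Ω)
    (𝒯 : Triangulation Ω)
    (hresolve : ∀ S : 𝒯.Side, hull S.1 ⊆ frontier Ω → relint S.1 ⊆ ΓD ∨ relint S.1 ⊆ ΓN)
    (φ : Pt d → Matrix (Fin ℓ) (Fin d) ℝ → EReal) (ψ : Pt d → (Fin ℓ → ℝ) → EReal)
    (hφ : ∀ᵐ x ∂(volume.restrict Ω), IsProperConvexLsc (φ x))
    (hψ : ∀ᵐ x ∂(volume.restrict Ω), IsProperConvexLsc (ψ x))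
    (hφc : 𝒯.IsElementwiseConstant φ) (hψc : 𝒯.IsElementwiseConstant ψ)
    (g : 𝒯.SideOn ΓN → Fin ℓ → ℝ) (uD : 𝒯.SideOn ΓD → Fin ℓ → ℝ) :
    (⨆ y : 𝒯.Zrt ℓ, 𝒯.dual φ ψ g uD y) ≤ (⨅ v : 𝒯.Ucr ℓ, 𝒯.primal φ ψ g uD v) ∧
    ∀ (u : 𝒯.Ucr ℓ) (z : 𝒯.Zrt ℓ),
      (∀ v : 𝒯.Ucr ℓ, 𝒯.primal φ ψ g uD u ≤ 𝒯.primal φ ψ g uD v) →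
      (∀ y : 𝒯.Zrt ℓ, 𝒯.dual φ ψ g uD y ≤ 𝒯.dual φ ψ g uD z) →
      (∀ S : 𝒯.SideOn ΓD, u.sideMean S.1 = uD S) →
      (∀ S : 𝒯.SideOn ΓN, z.normalTrace S.1 = g S) →
      (𝒯.primal φ ψ g uD u = 𝒯.dual φ ψ g uD z ↔
        (∀ᵐ x ∂(volume.restrict Ω), ((frob (z.mean x) (u.grad x) : ℝ) : EReal)
            = conj frob (φ x) (z.mean x) + φ x (u.grad x)) ∧
        (∀ᵐ x ∂(volume.restrict Ω), ((dot (z.div x) (u.mean x) : ℝ) : EReal)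
            = conj dot (ψ x) (z.div x) + ψ x (u.mean x))) := by
  open Triangulation in
  choose φ₀ hφ₀ using hφc
  choose ψ₀ hψ₀ using hψc
  have hφp : ∀ T, IsProper (φ₀ T) := 
    of_ae_restrict hΩ (P := IsProper) (hφ.mono fun x hx => hx.proper) hφ₀
  have hψp : ∀ T, IsProper (ψ₀ T) := 
    of_ae_restrict hΩ (P := IsProper) (hψ.mono fun x hx => hx.proper) hψ₀
  have hgrad : ∀ (v : 𝒯.Ucr ℓ) {T : 𝒯.Elem} {x : Pt d}, x ∈ interior (hull T.1) →
      v.grad x = elemGrad v T := fun v _ _ hx => piecewise_eq _ hx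
  have hmean : ∀ (v : 𝒯.Ucr ℓ) {T : 𝒯.Elem} {x : Pt d}, x ∈ interior (hull T.1) →
      v.mean x = elemMean v T := fun v _ _ hx => piecewise_eq _ hx
  have hflux : ∀ (y : 𝒯.Zrt ℓ) {T : 𝒯.Elem} {x : Pt d}, x ∈ interior (hull T.1) →
      y.mean x = elemFlux y T := fun v _ _ hx => piecewise_eq _ hx
  have hdiv : ∀ (y : 𝒯.Zrt ℓ) {T : 𝒯.Elem} {x : Pt d}, x ∈ interior (hull T.1) →
      y.div x = elemDiv y T := fun v _ _ hx => piecewise_eq _ hx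
  have hI₁ := fun v : 𝒯.Ucr ℓ => isWeightedSum_eintegral hΩ (f := fun x => φ x (v.grad x))
    (a := fun T => φ₀ T (elemGrad v T)) (fun T => (hφp T).1 _)
    fun T => (ae_eq_of_ae_eq_const (hφ₀ T)).mono fun x hx => by rw [hx.1, hgrad v hx.2]
  have hI₂ := fun v : 𝒯.Ucr ℓ => isWeightedSum_eintegral hΩ (f := fun x => ψ x (v.mean x))
    (a := fun T => ψ₀ T (elemMean v T)) (fun T => (hψp T).1 _)
    fun T => (ae_eq_of_ae_eq_const (hψ₀ T)).mono fun x hx => by rw [hx.1, hmean v hx.2]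
  have hJ₁ := fun y : 𝒯.Zrt ℓ => isWeightedSum_eintegral hΩ
    (f := fun x => conj frob (φ x) (y.mean x))
    (a := fun T => conj frob (φ₀ T) (elemFlux y T)) (fun T => conj_ne_bot _ (hφp T) _)
    fun T => (ae_eq_of_ae_eq_const (hφ₀ T)).mono fun x hx => by rw [hx.1, hflux y hx.2]
  have hJ₂ := fun y : 𝒯.Zrt ℓ => isWeightedSum_eintegral hΩ
    (f := fun x => conj dot (ψ x) (y.div x))
    (a := fun T => conj dot (ψ₀ T) (elemDiv y T)) (fun T => conj_ne_bot _ (hψp T) _)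
    fun T => (ae_eq_of_ae_eq_const (hψ₀ T)).mono fun x hx => by rw [hx.1, hdiv y hx.2]
  have hparts := sum_frob_add_dot (ℓ := ℓ) hd hΩ hdisj hunion hresolve
  have hind : ∀ {Γ : Set (Pt d)} (b w : 𝒯.SideOn Γ → Fin ℓ → ℝ),
      𝒯.indicatorEq b w = 0 ∨ 𝒯.indicatorEq b w = ⊤ := fun b w => by
    unfold indicatorEq
    split_ifs
    exacts [Or.inl rfl, Or.inr rfl]
  have hind0 : ∀ {Γ : Set (Pt d)} {b w : 𝒯.SideOn Γ → Fin ℓ → ℝ},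
      𝒯.indicatorEq b w = 0 → w = b := fun {_ b w} h => by
    unfold indicatorEq at h
    split_ifs at h with hwb
    · exact hwb
    · exact absurd h (by simp)
  refine ⟨iSup_le fun y => le_iInf fun v => ?_, fun u z _ _ hu hz => ?_⟩
  · refine dual_le_primal (fun T => (volume_real_hull_pos T).le) (hI₁ v) (hI₂ v) (hJ₁ y) (hJ₂ y)
      (fun T => le_conj_add frob (hφp T) _ _) (fun T => le_conj_add dot (hψp T) _ _)
      (hind _ _) (hind _ _) fun hi hj => ?_
    -- When both indicators vanish, the boundary conditions turn the boundary terms into the linear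
    -- terms of the two functionals.
    rw [hparts v y, hind0 hi, hind0 hj]
  · have hu' : (fun S : 𝒯.SideOn ΓD => u.sideMean S.1) = uD := funext hu
    have hz' : (fun S : 𝒯.SideOn ΓN => z.normalTrace S.1) = g := funext hz
    have hst := hparts u z
    rw [hu', hz'] at hst
    have key := primal_eq_dual_iff (fun T => volume_real_hull_pos T) (hI₁ u) (hI₂ u) (hJ₁ z)
      (hJ₂ z) (fun T => (hφp T).1 _) (fun T => (hψp T).1 _) (fun T => conj_ne_bot _ (hφp T) _)
      (fun T => conj_ne_bot _ (hψp T) _) (fun T => le_conj_add frob (hφp T) _ _)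
      (fun T => le_conj_add dot (hψp T) _ _) hst
    have h₁ := ae_restrict_iff_forall_elem hΩ
      (P := fun x => ((frob (z.mean x) (u.grad x) : ℝ) : EReal)
            = conj frob (φ x) (z.mean x) + φ x (u.grad x))
      (Q := fun T => ((frob (elemFlux z T) (elemGrad u T) : ℝ) : EReal)
            = conj frob (φ₀ T) (elemFlux z T) + φ₀ T (elemGrad u T))
      fun T => (ae_eq_of_ae_eq_const (hφ₀ T)).mono fun x hx => by
        rw [hx.1, hflux z hx.2, hgrad u hx.2]
    have h₂ := ae_restrict_iff_forall_elem hΩ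
      (P := fun x => ((dot (z.div x) (u.mean x) : ℝ) : EReal)
            = conj dot (ψ x) (z.div x) + ψ x (u.mean x))
      (Q := fun T => ((dot (elemDiv z T) (elemMean u T) : ℝ) : EReal)
            = conj dot (ψ₀ T) (elemDiv z T) + ψ₀ T (elemMean u T))
      fun T => (ae_eq_of_ae_eq_const (hψ₀ T)).mono fun x hx => by
        rw [hx.1, hdiv z hx.2, hmean u hx.2]
    rw [h₁, h₂, ← key]
    have hi : 𝒯.indicatorEq uD (fun S => u.sideMean S.1) = 0 := if_pos hu'
    have hj : 𝒯.indicatorEq g (fun S => z.normalTrace S.1) = 0 := if_pos hz'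
    rw [primal, dual, hi, hj]
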